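/- Let $\mathbb{K}$ be a field, $A$ a $\mathbb{K}$-algebra, $\Omega^1$ an $A$-bimodule and $d:A\to\Omega^1$ a first order differential calculus, i.e. $d$ is $\mathbb{K}$-linear and $d(ab)=(da)b+a\,db$. Assume that the calculus is surjective, i.e. $\Omega^1$ is spanned by the elements $a\,db$. Then $\Omega^1=\Omega^1_{\mathrm{uni}}/\mathcal{N}$, where $\Omega^1_{\mathrm{uni}}=\ker(A\otimes_{\mathbb{K}}A\to A)$, $d_{\mathrm{uni}}a=a\otimes 1-1\otimes a$, and $\mathcal{N}$ is the kernel of the bimodule map $\Omega^1_{\mathrm{uni}}\to\Omega^1$, $d_{\mathrm{uni}}a\mapsto da$. Let $\mathfrak{X}^1$ be a left dual of $\Omega^1$ in the category of $A$-bimodules, with evaluation $\mathrm{ev}:\mathfrak{X}^1\otimes_A\Omega^1\to A$ and coevaluation $\mathrm{coev}(1)=\sum_i\omega_i\otimes x_i\in\Omega^1\otimes_A\mathfrak{X}^1$, and let $\mathfrak{Y}^1$ be a right dual, with evaluation $\underline{\mathrm{ev}}:\Omega^1\otimes_A\mathfrak{Y}^1\to A$ and coevaluation $\underline{\mathrm{coev}}(1)=\sum_j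 y_j\otimes\rho_j\in\mathfrak{Y}^1\otimes_A\Omega^1$. Write $A^e=A\otimes_{\mathbb K}A^{\mathrm{op}}$, $a\overline{b}=a\otimes b\in A^e$, $\star$ for the free product of $\mathbb{K}$-algebras, $T_{\mathbb{K}}$ for the tensor algebra, $\bullet$ for the product of the algebras below and $[f,g]=f\bullet g-g\bullet f$. Denote by $(x,\omega)$ and $(\omega,y)$ the generators $x\otimes\omega\in\mathfrak{X}^1\otimes_{\mathbb{K}}\Omega^1$ and $\omega\otimes y\in\Omega^1\otimes_{\mathbb{K}}\mathfrak{Y}^1$, and by $\overline{y}$ the generator given by $y\in\mathfrak{Y}^1$ in $T_{\mathbb{K}}\mathfrak{Y}^1$. In the relations below, $a,a',b,b'\in A$, $x\in\mathfrak{X}^1$, $y\in\mathfrak{Y}^1$ and $\omega\in\Omega^1$ are arbitrary. * $B\mathfrak{X}^1$ is the quotient of $A^e\star T_{\mathbb{K}}\mathfrak{X}^1\star T_{\mathbb{K}}(\mathfrak{X}^1\otimes_{\mathbb{K}}\Omega^1)$ by the relations $a\bullet x=ax$, $\;x\bullet a=xa+\mathrm{ev}(x\otimes da)$, $\;x\bullet\overline{a}=\overline{a}\bullet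 x+(x,da)$, $\;a\overline{a'}\bullet(x,\omega)\bullet b\overline{b'}=(axb,b'\omega a')$. * $IB\mathfrak{X}^1$ is the quotient of $A^e\star T_{\mathbb{K}}\mathfrak{X}^1\star T_{\mathbb{K}}(\mathfrak{X}^1\otimes_{\mathbb{K}}\Omega^1)\star T_{\mathbb{K}}(\Omega^1\otimes_{\mathbb{K}}\mathfrak{Y}^1)$ by these relations and $a\overline{a'}\bullet(\omega,y)\bullet b\overline{b'}=(a\omega b,b'ya')$, $\;\sum_i(\omega_i,y)\bullet(x_i,\omega)=\overline{\underline{\mathrm{ev}}(\omega\otimes y)}$, $\;\sum_j(x,\rho_j)\bullet(\omega,y_j)=\mathrm{ev}(x\otimes\omega)$. * $T\mathfrak{X}^1_\bullet$ is the quotient of $A\star T_{\mathbb{K}}\mathfrak{X}^1$ by $a\bullet x=ax$ and $x\bullet a=xa+\mathrm{ev}(x\otimes da)$, and $B$ is the quotient of $A^{\mathrm{op}}\star T\mathfrak{X}^1_\bullet$ by $a\bullet\overline{b}=\overline{b}\bullet a$ and $\sum_m\overline{s_m}\bullet x\bullet\overline{r_m}=0$ for $\sum_m r_m\otimes s_m\in\mathcal{N}$.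 Then: 1. There are $b_i\in A$, $x_i'\in\mathfrak{X}^1$ with $\mathrm{coev}(1)=\sum_i db_i\otimes x'_i$, and $y'_j\in\mathfrak{Y}^1$, $c_j\in A$ with $\underline{\mathrm{coev}}(1)=\sum_j y'_j\otimes dc_j$. 2. $B\mathfrak{X}^1\cong B$ as algebras, by an isomorphism which fixes the generators from $A^e$ and $\mathfrak{X}^1$ and sends $(x,a\,db)$ to $[x,\overline{b}]\bullet\overline{a}$. 3. For every choice as in 1, $IB\mathfrak{X}^1$ is isomorphic as an algebra to the quotient of $B\star T_{\mathbb{K}}\mathfrak{Y}^1$ by the relations $$\overline{a}\bullet\overline{y}=\overline{ya},\qquad \overline{y}\bullet\overline{a}=\overline{ay}+\overline{\underline{\mathrm{ev}}(da\otimes y)},\qquad \sum_m r_m\bullet\overline{y}\bullet s_m=0\ \text{ for } \sum_m r_m\otimes s_m\in\mathcal{N},$$ $$\sum_i[\overline{y},b_i]\bullet x'_i=\overline{y},\qquad \sum_j[x,\overline{c_j}]\bullet\overline{y'_j}=x.$$ The isomorphism can be chosen to fix the generators from $A^e$ and $\mathfrak{X}^1$ and to send $(x,a\,db)$ to $[x,\overline{b}]\bullet\overline{a}$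 and $(a\,db,y)$ to $a\bullet[\overline{y},b]$, its inverse sending $\overline{y}$ to $\sum_i(db_i,y)\bullet x'_i$. Hence the generators from $\mathfrak{X}^1\otimes\Omega^1$ and $\Omega^1\otimes\mathfrak{Y}^1$ are eliminated. -/

import Mathlib

open scoped TensorProduct
open MulOpposite (op)

namespace SurjCalc

universe u v w

noncomputable section

/-! ### Free products of two algebras

The free product (coproduct) of two `K`-algebras, as the two-element case of
`LinearAlgebra.FreeProduct`. -/

/-- The family of two algebras `R`, `S`, lifted to a common universe. -/
def Pair (R : Type u) (S : Type v) : Bool → Type (max u v)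
  | false => ULift.{v} R
  | true => ULift.{u} S

instance Pair.instSemiring (R : Type u) (S : Type v) [Semiring R] [Semiring S] :
    (i : Bool) → Semiring (Pair R S i)
  | false => inferInstanceAs (Semiring (ULift.{v} R))
  | true => inferInstanceAs (Semiring (ULift.{u} S))

instance Pair.instAlgebra (K : Type w) (R : Type u) (S : Type v) [CommSemiring K]
    [Semiring R] [Semiring S] [Algebra K R] [Algebra K S] :
    (i : Bool) → Algebra K (Pair R S i)
  | false => inferInstanceAs (Algebra K (ULift.{v} R))
  | true => inferInstanceAs (Algebra K (ULift.{u} S))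

/-- The free product `R ⋆ S` of `K`-algebras. -/
abbrev Coprod (K : Type w) (R : Type u) (S : Type v) [CommRing K]
    [Semiring R] [Semiring S] [Algebra K R] [Algebra K S] : Type (max u v w) :=
  LinearAlgebra.FreeProduct K (Pair R S)

namespace Coprod

/-- The canonical map `R → R ⋆ S`. -/
def inl (K : Type w) (R : Type u) (S : Type v) [CommRing K]
    [Semiring R] [Semiring S] [Algebra K R] [Algebra K S] : R →ₐ[K] Coprod K R S :=
  (LinearAlgebra.FreeProduct.ι K (Pair R S) false).comp
    (ULift.algEquiv (R := K) (A := R)).symm.toAlgHom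

/-- The canonical map `S → R ⋆ S`. -/
def inr (K : Type w) (R : Type u) (S : Type v) [CommRing K]
    [Semiring R] [Semiring S] [Algebra K R] [Algebra K S] : S →ₐ[K] Coprod K R S :=
  (LinearAlgebra.FreeProduct.ι K (Pair R S) true).comp
    (ULift.algEquiv (R := K) (A := S)).symm.toAlgHom

end Coprod

/-! ### Calculi and dual bimodules

An `A`-bimodule is a `K`-space `M` with commuting `K`-linear actions of `A` and `Aᵐᵒᵖ`; the right
action of `a` on `m` is written `op a • m`. -/

/-- A first order differential calculus `d : A → Ω` on the `K`-algebra `A`. -/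
structure Calculus (K A Ω : Type*) [Field K] [Ring A] [Algebra K A] [AddCommGroup Ω]
    [Module K Ω] [Module A Ω] [Module Aᵐᵒᵖ Ω] where
  d : A →ₗ[K] Ω
  leibniz : ∀ a b : A, d (a * b) = a • d b + op b • d a

namespace Calculus

variable {K A Ω : Type*} [Field K] [Ring A] [Algebra K A] [AddCommGroup Ω]
  [Module K Ω] [Module A Ω] [Module Aᵐᵒᵖ Ω]

/-- The calculus is surjective: `Ω` is spanned by the elements `a db`. -/
def IsSurjective (D : Calculus K A Ω) : Prop :=
  Submodule.span K {ξ : Ω | ∃ a b : A, ξ = a • D.d b} = ⊤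

/-- The universal forms `Ω_uni = ker (A ⊗ A → A)`, with differential
`d_uni a = a ⊗ 1 - 1 ⊗ a`. -/
def universalForms (K A : Type*) [Field K] [Ring A] [Algebra K A] : Submodule K (A ⊗[K] A) :=
  LinearMap.ker (LinearMap.mul' K A)

/-- The linear map `∑ r ⊗ s ↦ ∑ (dr) s`. Its restriction to `Ω_uni` is the bimodule map
`Ω_uni → Ω` which sends `d_uni a` to `da`. -/
def fromUniversal [IsScalarTower K Aᵐᵒᵖ Ω] (D : Calculus K A Ω) :
    A ⊗[K] A →ₗ[K] Ω :=
  TensorProduct.lift (LinearMap.mk₂ K (fun r s => op s • D.d r)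
    (fun r r' s => by simp) (fun c r s => by rw [map_smul, smul_comm])
    (fun r s s' => by rw [MulOpposite.op_add, add_smul])
    (fun c r s => by rw [MulOpposite.op_smul, smul_assoc]))

/-- The sub-bimodule `𝒩 ⊆ Ω_uni` with `Ω = Ω_uni / 𝒩`: the kernel of `Ω_uni → Ω`. -/
def N [IsScalarTower K Aᵐᵒᵖ Ω] (D : Calculus K A Ω) :
    Submodule K (A ⊗[K] A) :=
  universalForms K A ⊓ LinearMap.ker D.fromUniversal

/-- For a surjective calculus `Ω_uni → Ω` is onto, so that `Ω = Ω_uni / 𝒩`. -/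
theorem map_fromUniversal [IsScalarTower K Aᵐᵒᵖ Ω]
    (D : Calculus K A Ω) (h : D.IsSurjective) :
    (universalForms K A).map D.fromUniversal = ⊤ := by
  rw [eq_top_iff, ← h, Submodule.span_le]
  rintro _ ⟨a, b, rfl⟩
  refine ⟨(a * b) ⊗ₜ 1 - a ⊗ₜ b, ?_, ?_⟩
  · simp [universalForms]
  · simp [fromUniversal, D.leibniz]

end Calculus

section Duals

variable (K A Ω X Y : Type*) [Field K] [Ring A] [Algebra K A]
  [AddCommGroup Ω] [Module K Ω] [Module A Ω] [Module Aᵐᵒᵖ Ω]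
  [AddCommGroup X] [Module K X] [Module A X] [Module Aᵐᵒᵖ X]
  [AddCommGroup Y] [Module K Y] [Module A Y] [Module Aᵐᵒᵖ Y]

/-- A bimodule map `ev : X ⊗_A Ω → A`. -/
structure LeftPairing where
  ev : X →ₗ[K] Ω →ₗ[K] A
  ev_smul : ∀ (a : A) (x : X) (ξ : Ω), ev (a • x) ξ = a * ev x ξ
  ev_balanced : ∀ (a : A) (x : X) (ξ : Ω), ev (op a • x) ξ = ev x (a • ξ)
  ev_op_smul : ∀ (a : A) (x : X) (ξ : Ω), ev x (op a • ξ) = ev x ξ * a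

/-- A bimodule map `ev : Ω ⊗_A Y → A`. -/
structure RightPairing where
  ev : Ω →ₗ[K] Y →ₗ[K] A
  ev_smul : ∀ (a : A) (ξ : Ω) (y : Y), ev (a • ξ) y = a * ev ξ y
  ev_balanced : ∀ (a : A) (ξ : Ω) (y : Y), ev (op a • ξ) y = ev ξ (a • y)
  ev_op_smul : ∀ (a : A) (ξ : Ω) (y : Y), ev ξ (op a • y) = ev ξ y * a

variable {K A Ω X Y}

/-- `∑ i, ω i ⊗ x i ∈ Ω ⊗_A X` is the value at `1` of a coevaluation `A → Ω ⊗_A X` which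
makes `X` the left dual bimodule of `Ω` with evaluation `ev`. These are the two triangle
identities; they determine `∑ i, ω i ⊗ x i` and imply that it commutes with `A`. -/
def LeftPairing.IsCoev (P : LeftPairing K A Ω X) {n : ℕ} (ω : Fin n → Ω) (x : Fin n → X) :
    Prop :=
  (∀ ξ : Ω, ∑ i, op (P.ev (x i) ξ) • ω i = ξ) ∧ (∀ z : X, ∑ i, P.ev z (ω i) • x i = z)

/-- `∑ j, y j ⊗ ρ j ∈ Y ⊗_A Ω` is the value at `1` of a coevaluation `A → Y ⊗_A Ω` which
makes `Y` the right dual bimodule of `Ω` with evaluation `ev`. -/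
def RightPairing.IsCoev (Q : RightPairing K A Ω Y) {n : ℕ} (y : Fin n → Y) (ρ : Fin n → Ω) :
    Prop :=
  (∀ ξ : Ω, ∑ j, Q.ev ξ (y j) • ρ j = ξ) ∧ (∀ z : Y, ∑ j, op (Q.ev (ρ j) z) • y j = z)

end Duals

/-! ### The algebras -/

section Algebras

variable {K A Ω X Y : Type*} [Field K] [Ring A] [Algebra K A]
  [AddCommGroup Ω] [Module K Ω] [Module A Ω] [Module Aᵐᵒᵖ Ω]
  [AddCommGroup X] [Module K X] [Module A X] [Module Aᵐᵒᵖ X]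
  [AddCommGroup Y] [Module K Y] [Module A Y] [Module Aᵐᵒᵖ Y]

/-- The relations `a • x = ax` and `x • a = xa + ev(x, da)` between the images of `A` and `X`. -/
inductive ConnRel (D : Calculus K A Ω) (P : LeftPairing K A Ω X) {F : Type*} [Ring F]
    (s : A → F) (v : X → F) : F → F → Prop
  | left (a : A) (x : X) : ConnRel D P s v (s a * v x) (v (a • x))
  | right (a : A) (x : X) :
      ConnRel D P s v (v x * s a) (v (op a • x) + s (P.ev x (D.d a)))

/-- The relations of `B𝔛`, between the images `e` of `Aᵉ = A ⊗ Aᵐᵒᵖ`, `v` of `X` and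
`p` of `X ⊗ Ω`. -/
inductive BXRel (D : Calculus K A Ω) (P : LeftPairing K A Ω X) {F : Type*} [Ring F]
    (e : A ⊗[K] Aᵐᵒᵖ → F) (v : X → F) (p : X ⊗[K] Ω → F) : F → F → Prop
  | conn {f g : F} : ConnRel D P (fun a => e (a ⊗ₜ 1)) v f g → BXRel D P e v p f g
  | bar (a : A) (x : X) :
      BXRel D P e v p (v x * e (1 ⊗ₜ op a)) (e (1 ⊗ₜ op a) * v x + p (x ⊗ₜ D.d a))
  | act (a a' b b' : A) (x : X) (ξ : Ω) :
      BXRel D P e v p (e (a ⊗ₜ op a') * p (x ⊗ₜ ξ) * e (b ⊗ₜ op b'))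
        (p ((a • op b • x) ⊗ₜ (b' • op a' • ξ)))

/-- The relations of `IB𝔛`: those of `B𝔛`, and those involving the image `q` of `Ω ⊗ Y`. -/
inductive IBXRel (D : Calculus K A Ω) (P : LeftPairing K A Ω X) (Q : RightPairing K A Ω Y)
    {n m : ℕ} (ω : Fin n → Ω) (x : Fin n → X) (y : Fin m → Y) (ρ : Fin m → Ω)
    {F : Type*} [Ring F]
    (e : A ⊗[K] Aᵐᵒᵖ → F) (v : X → F) (p : X ⊗[K] Ω → F) (q : Ω ⊗[K] Y → F) : F → F → Prop
  | base {f g : F} : BXRel D P e v p f g → IBXRel D P Q ω x y ρ e v p q f g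
  | act (a a' b b' : A) (ξ : Ω) (z : Y) :
      IBXRel D P Q ω x y ρ e v p q (e (a ⊗ₜ op a') * q (ξ ⊗ₜ z) * e (b ⊗ₜ op b'))
        (q ((a • op b • ξ) ⊗ₜ (b' • op a' • z)))
  | inv₁ (ξ : Ω) (z : Y) :
      IBXRel D P Q ω x y ρ e v p q (∑ i, q (ω i ⊗ₜ z) * p (x i ⊗ₜ ξ)) (e (1 ⊗ₜ op (Q.ev ξ z)))
  | inv₂ (z : X) (ξ : Ω) :
      IBXRel D P Q ω x y ρ e v p q (∑ j, p (z ⊗ₜ ρ j) * q (ξ ⊗ₜ y j)) (e (P.ev z ξ ⊗ₜ 1))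

/-- The relations of the second presentation of `B𝔛`, between the images `t` of `Aᵐᵒᵖ`,
`s` of `A` and `v` of `X`. -/
inductive SurjBXRel [IsScalarTower K Aᵐᵒᵖ Ω] (D : Calculus K A Ω)
    {F : Type*} [Ring F] (t : Aᵐᵒᵖ → F) (s : A → F) (v : X → F) : F → F → Prop
  | comm (a b : A) : SurjBXRel D t s v (s a * t (op b)) (t (op b) * s a)
  | surj {n : ℕ} (r r' : Fin n → A) (x : X) (h : ∑ m, r m ⊗ₜ[K] r' m ∈ D.N) :
      SurjBXRel D t s v (∑ m, t (op (r' m)) * v x * t (op (r m))) 0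

/-- The relations of the second presentation of `IB𝔛`, between the images `t` of `Aᵐᵒᵖ`,
`s` of `A`, `v` of `X` and `u` of `Y`. Here `∑ i, db i ⊗ x i` and `∑ j, y j ⊗ dc j` are the
two coevaluations at `1`. -/
inductive SurjIBXRel [IsScalarTower K Aᵐᵒᵖ Ω] (D : Calculus K A Ω)
    (Q : RightPairing K A Ω Y) {n m : ℕ} (b : Fin n → A) (x : Fin n → X)
    (y : Fin m → Y) (c : Fin m → A) {F : Type*} [Ring F]
    (t : Aᵐᵒᵖ → F) (s : A → F) (v : X → F) (u : Y → F) : F → F → Prop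
  | left (a : A) (z : Y) :
      SurjIBXRel D Q b x y c t s v u (t (op a) * u z) (u (op a • z))
  | right (a : A) (z : Y) :
      SurjIBXRel D Q b x y c t s v u (u z * t (op a)) (u (a • z) + t (op (Q.ev (D.d a) z)))
  | surj {k : ℕ} (r r' : Fin k → A) (z : Y) (h : ∑ l, r l ⊗ₜ[K] r' l ∈ D.N) :
      SurjIBXRel D Q b x y c t s v u (∑ l, s (r l) * u z * s (r' l)) 0
  | inv₁ (z : Y) :
      SurjIBXRel D Q b x y c t s v u (∑ i, (u z * s (b i) - s (b i) * u z) * v (x i)) (u z)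
  | inv₂ (z : X) :
      SurjIBXRel D Q b x y c t s v u
        (∑ j, (v z * t (op (c j)) - t (op (c j)) * v z) * u (y j)) (v z)

end Algebras

/-! #### The algebra `B𝔛`, a quotient of `Aᵉ ⋆ T X ⋆ T (X ⊗ Ω)` -/

section BX

variable (K A Ω X : Type*) [Field K] [Ring A] [Algebra K A]
  [AddCommGroup Ω] [Module K Ω] [AddCommGroup X] [Module K X]

/-- `Aᵉ ⋆ T X ⋆ T (X ⊗ Ω)`. -/
abbrev BXFree : Type _ :=
  Coprod K (Coprod K (A ⊗[K] Aᵐᵒᵖ) (TensorAlgebra K X)) (TensorAlgebra K (X ⊗[K] Ω))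

def BXFree.e : A ⊗[K] Aᵐᵒᵖ →ₐ[K] BXFree K A Ω X := (Coprod.inl K _ _).comp (Coprod.inl K _ _)

def BXFree.v : X →ₗ[K] BXFree K A Ω X :=
  ((Coprod.inl K _ _).comp (Coprod.inr K _ _)).toLinearMap ∘ₗ TensorAlgebra.ι K

def BXFree.p : X ⊗[K] Ω →ₗ[K] BXFree K A Ω X :=
  (Coprod.inr K _ _).toLinearMap ∘ₗ TensorAlgebra.ι K

variable {K A Ω X} [Module A Ω] [Module Aᵐᵒᵖ Ω] [Module A X] [Module Aᵐᵒᵖ X]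

/-- The relations of `B𝔛` in `Aᵉ ⋆ T X ⋆ T (X ⊗ Ω)`. -/
abbrev BXr (D : Calculus K A Ω) (P : LeftPairing K A Ω X) :
    BXFree K A Ω X → BXFree K A Ω X → Prop :=
  BXRel D P (BXFree.e K A Ω X) (BXFree.v K A Ω X) (BXFree.p K A Ω X)

/-- The algebra `B𝔛`. -/
abbrev BX (D : Calculus K A Ω) (P : LeftPairing K A Ω X) : Type _ := RingQuot (BXr D P)

variable (D : Calculus K A Ω) (P : LeftPairing K A Ω X)

def BX.e : A ⊗[K] Aᵐᵒᵖ →ₐ[K] BX D P :=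
  (RingQuot.mkAlgHom K (BXr D P)).comp (BXFree.e K A Ω X)

def BX.v : X →ₗ[K] BX D P :=
  (RingQuot.mkAlgHom K (BXr D P)).toLinearMap ∘ₗ BXFree.v K A Ω X

def BX.p : X ⊗[K] Ω →ₗ[K] BX D P :=
  (RingQuot.mkAlgHom K (BXr D P)).toLinearMap ∘ₗ BXFree.p K A Ω X

end BX

/-! #### The algebra `IB𝔛`, a quotient of `Aᵉ ⋆ T X ⋆ T (X ⊗ Ω) ⋆ T (Ω ⊗ Y)` -/

section IBX

variable (K A Ω X Y : Type*) [Field K] [Ring A] [Algebra K A]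
  [AddCommGroup Ω] [Module K Ω] [AddCommGroup X] [Module K X] [AddCommGroup Y] [Module K Y]

/-- `Aᵉ ⋆ T X ⋆ T (X ⊗ Ω) ⋆ T (Ω ⊗ Y)`. -/
abbrev IBXFree : Type _ := Coprod K (BXFree K A Ω X) (TensorAlgebra K (Ω ⊗[K] Y))

def IBXFree.e : A ⊗[K] Aᵐᵒᵖ →ₐ[K] IBXFree K A Ω X Y :=
  (Coprod.inl K _ _).comp (BXFree.e K A Ω X)

def IBXFree.v : X →ₗ[K] IBXFree K A Ω X Y := (Coprod.inl K _ _).toLinearMap ∘ₗ BXFree.v K A Ω X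

def IBXFree.p : X ⊗[K] Ω →ₗ[K] IBXFree K A Ω X Y :=
  (Coprod.inl K _ _).toLinearMap ∘ₗ BXFree.p K A Ω X

def IBXFree.q : Ω ⊗[K] Y →ₗ[K] IBXFree K A Ω X Y :=
  (Coprod.inr K _ _).toLinearMap ∘ₗ TensorAlgebra.ι K

variable {K A Ω X Y} [Module A Ω] [Module Aᵐᵒᵖ Ω] [Module A X] [Module Aᵐᵒᵖ X]
  [Module A Y] [Module Aᵐᵒᵖ Y]

/-- The relations of `IB𝔛` in `Aᵉ ⋆ T X ⋆ T (X ⊗ Ω) ⋆ T (Ω ⊗ Y)`. -/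
abbrev IBXr (D : Calculus K A Ω) (P : LeftPairing K A Ω X) (Q : RightPairing K A Ω Y)
    {n m : ℕ} (ω : Fin n → Ω) (x : Fin n → X) (y : Fin m → Y) (ρ : Fin m → Ω) :
    IBXFree K A Ω X Y → IBXFree K A Ω X Y → Prop :=
  IBXRel D P Q ω x y ρ (IBXFree.e K A Ω X Y) (IBXFree.v K A Ω X Y) (IBXFree.p K A Ω X Y)
    (IBXFree.q K A Ω X Y)

/-- The algebra `IB𝔛`, where `∑ i, ω i ⊗ x i` and `∑ j, y j ⊗ ρ j` are the two coevaluations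
at `1`. -/
abbrev IBX (D : Calculus K A Ω) (P : LeftPairing K A Ω X) (Q : RightPairing K A Ω Y)
    {n m : ℕ} (ω : Fin n → Ω) (x : Fin n → X) (y : Fin m → Y) (ρ : Fin m → Ω) : Type _ :=
  RingQuot (IBXr D P Q ω x y ρ)

variable (D : Calculus K A Ω) (P : LeftPairing K A Ω X) (Q : RightPairing K A Ω Y)
    {n m : ℕ} (ω : Fin n → Ω) (x : Fin n → X) (y : Fin m → Y) (ρ : Fin m → Ω)

def IBX.e : A ⊗[K] Aᵐᵒᵖ →ₐ[K] IBX D P Q ω x y ρ :=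
  (RingQuot.mkAlgHom K (IBXr D P Q ω x y ρ)).comp (IBXFree.e K A Ω X Y)

def IBX.v : X →ₗ[K] IBX D P Q ω x y ρ :=
  (RingQuot.mkAlgHom K (IBXr D P Q ω x y ρ)).toLinearMap ∘ₗ IBXFree.v K A Ω X Y

def IBX.p : X ⊗[K] Ω →ₗ[K] IBX D P Q ω x y ρ :=
  (RingQuot.mkAlgHom K (IBXr D P Q ω x y ρ)).toLinearMap ∘ₗ IBXFree.p K A Ω X Y

def IBX.q : Ω ⊗[K] Y →ₗ[K] IBX D P Q ω x y ρ :=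
  (RingQuot.mkAlgHom K (IBXr D P Q ω x y ρ)).toLinearMap ∘ₗ IBXFree.q K A Ω X Y

end IBX

/-! #### The algebra `T𝔛` of left connections, and the second presentation of `B𝔛` -/

section SurjBX

variable {K A Ω X : Type*} [Field K] [Ring A] [Algebra K A]
  [AddCommGroup Ω] [Module K Ω] [Module A Ω] [Module Aᵐᵒᵖ Ω]
  [AddCommGroup X] [Module K X] [Module A X] [Module Aᵐᵒᵖ X]
  (D : Calculus K A Ω) (P : LeftPairing K A Ω X)

/-- The relations of `T𝔛` in `A ⋆ T X`. -/
abbrev TXr : Coprod K A (TensorAlgebra K X) → Coprod K A (TensorAlgebra K X) → Prop :=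
  ConnRel D P (Coprod.inl K A (TensorAlgebra K X))
    (fun x => Coprod.inr K A (TensorAlgebra K X) (TensorAlgebra.ι K x))

/-- The algebra `T𝔛`. -/
abbrev TX : Type _ := RingQuot (TXr D P)

def TX.s : A →ₐ[K] TX D P := (RingQuot.mkAlgHom K (TXr D P)).comp (Coprod.inl K _ _)

def TX.v : X →ₗ[K] TX D P :=
  ((RingQuot.mkAlgHom K (TXr D P)).comp (Coprod.inr K _ _)).toLinearMap ∘ₗ TensorAlgebra.ι K

variable [IsScalarTower K Aᵐᵒᵖ Ω]

/-- The relations of the second presentation of `B𝔛` in `Aᵐᵒᵖ ⋆ T𝔛`. -/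
abbrev SurjBXr : Coprod K Aᵐᵒᵖ (TX D P) → Coprod K Aᵐᵒᵖ (TX D P) → Prop :=
  SurjBXRel D (Coprod.inl K Aᵐᵒᵖ (TX D P))
    (fun a => Coprod.inr K Aᵐᵒᵖ (TX D P) (TX.s D P a))
    (fun x => Coprod.inr K Aᵐᵒᵖ (TX D P) (TX.v D P x))

/-- The second presentation of `B𝔛`. -/
abbrev SurjBX : Type _ := RingQuot (SurjBXr D P)

def SurjBX.t : Aᵐᵒᵖ →ₐ[K] SurjBX D P :=
  (RingQuot.mkAlgHom K (SurjBXr D P)).comp (Coprod.inl K _ _)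

def SurjBX.s : A →ₐ[K] SurjBX D P :=
  ((RingQuot.mkAlgHom K (SurjBXr D P)).comp (Coprod.inr K _ _)).comp (TX.s D P)

def SurjBX.v : X →ₗ[K] SurjBX D P :=
  ((RingQuot.mkAlgHom K (SurjBXr D P)).comp (Coprod.inr K _ _)).toLinearMap ∘ₗ TX.v D P

end SurjBX

/-! #### The second presentation of `IB𝔛`, a quotient of `B𝔛 ⋆ T Y` -/

section SurjIBX

variable {K A Ω X Y : Type*} [Field K] [Ring A] [Algebra K A]
  [AddCommGroup Ω] [Module K Ω] [Module A Ω] [Module Aᵐᵒᵖ Ω]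
  [AddCommGroup X] [Module K X] [Module A X] [Module Aᵐᵒᵖ X]
  [AddCommGroup Y] [Module K Y] [Module A Y] [Module Aᵐᵒᵖ Y]
  [IsScalarTower K Aᵐᵒᵖ Ω]
  (D : Calculus K A Ω) (P : LeftPairing K A Ω X) (Q : RightPairing K A Ω Y)
  {n m : ℕ} (b : Fin n → A) (x : Fin n → X) (y : Fin m → Y) (c : Fin m → A)

/-- The relations of the second presentation of `IB𝔛` in `B𝔛 ⋆ T Y`. -/
abbrev SurjIBXr : Coprod K (SurjBX D P) (TensorAlgebra K Y) →
    Coprod K (SurjBX D P) (TensorAlgebra K Y) → Prop :=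
  SurjIBXRel D Q b x y c
    (fun a => Coprod.inl K (SurjBX D P) (TensorAlgebra K Y) (SurjBX.t D P a))
    (fun a => Coprod.inl K (SurjBX D P) (TensorAlgebra K Y) (SurjBX.s D P a))
    (fun z => Coprod.inl K (SurjBX D P) (TensorAlgebra K Y) (SurjBX.v D P z))
    (fun z => Coprod.inr K (SurjBX D P) (TensorAlgebra K Y) (TensorAlgebra.ι K z))

/-- The second presentation of `IB𝔛`. -/
abbrev SurjIBX : Type _ := RingQuot (SurjIBXr D P Q b x y c)

/-- The canonical map from the second presentation of `B𝔛`. -/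
def SurjIBX.ofBX : SurjBX D P →ₐ[K] SurjIBX D P Q b x y c :=
  (RingQuot.mkAlgHom K (SurjIBXr D P Q b x y c)).comp (Coprod.inl K _ _)

def SurjIBX.t : Aᵐᵒᵖ →ₐ[K] SurjIBX D P Q b x y c :=
  (SurjIBX.ofBX D P Q b x y c).comp (SurjBX.t D P)

def SurjIBX.s : A →ₐ[K] SurjIBX D P Q b x y c :=
  (SurjIBX.ofBX D P Q b x y c).comp (SurjBX.s D P)

def SurjIBX.v : X →ₗ[K] SurjIBX D P Q b x y c :=
  (SurjIBX.ofBX D P Q b x y c).toLinearMap ∘ₗ SurjBX.v D P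

def SurjIBX.u : Y →ₗ[K] SurjIBX D P Q b x y c :=
  ((RingQuot.mkAlgHom K (SurjIBXr D P Q b x y c)).comp (Coprod.inr K _ _)).toLinearMap ∘ₗ
    TensorAlgebra.ι K

end SurjIBX

end

end SurjCalc

/-! All the algebras are given by generators and relations, so an algebra map out of one of them is
the same as maps on its generators that satisfy its relations in the target. Each isomorphism
therefore reduces to translating one system of relations into another over an arbitrary algebra `F`,
in both directions, and comparing the resulting maps on generators.

For `B𝔛`, the relation `x • ā = ā • x + (x, da)` and the right action of `Aᵐᵒᵖ` force `(x, a db) =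
[x, b̄] • ā`. Conversely, the right side is the value at `ab ⊗ 1 - a ⊗ b` of the linear map `r ⊗ s ↦
s̄ • x • r̄`. Such a map descends to `Ω = Ω_uni / 𝒩` as soon as it kills `𝒩`, which is the extra
relation of the second presentation (`IsSurjective.exists_map`, `SurjBXEqs.exists_p`,
`SurjBXEqs.toBXEqs`).

For `IB𝔛`, `(a db, y)` is obtained from `a • [ȳ, b]` in the same way. To go back, set `ȳ = ∑ (ω_i,
y) • x_i`. The coevaluation is central and `x • a = xa + ev(x, da)`, so moving `a` through this sum
gives `[ȳ, a] = (∑ ω_i ev(x_i, da), y) = (da, y)`, the last step being a triangle identity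
(`IBXEqs.elimY_mul_s`). The two relations inverting the matrices of generators then match the two
relations with `b_i` and `c_j` (`SurjIBXEqs.toIBXEqs`, `IBXEqs.toSurjIBXEqs`). They are balanced
over `A`, so the coevaluations may be replaced by ones made of exact forms (`IBXEqs.congr_coev`). -/

namespace SurjCalc

noncomputable section

/-! ### Universal properties -/

namespace Coprod

variable {K R S B : Type*} [CommRing K] [Semiring R] [Semiring S] [Algebra K R] [Algebra K S]
  [Semiring B] [Algebra K B]

/-- The algebra map out of a free product given by its restrictions to the two factors. -/
def lift (f : R →ₐ[K] B) (g : S →ₐ[K] B) : Coprod K R S →ₐ[K] B :=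
  LinearAlgebra.FreeProduct.lift K (Pair R S) fun {i} =>
    match i with
    | false => f.comp (ULift.algEquiv (R := K) (A := R)).toAlgHom
    | true => g.comp (ULift.algEquiv (R := K) (A := S)).toAlgHom

@[simp]
theorem lift_inl (f : R →ₐ[K] B) (g : S →ₐ[K] B) (r : R) : lift f g (inl K R S r) = f r :=
  DFunLike.congr_fun (LinearAlgebra.FreeProduct.lift_comp_ι (i := false) K (Pair R S) _)
    (ULift.up r)

@[simp]
theorem lift_inr (f : R →ₐ[K] B) (g : S →ₐ[K] B) (s : S) : lift f g (inr K R S s) = g s :=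
  DFunLike.congr_fun (LinearAlgebra.FreeProduct.lift_comp_ι (i := true) K (Pair R S) _)
    (ULift.up s)

theorem algHom_ext {f g : Coprod K R S →ₐ[K] B} (hl : f.comp (inl K R S) = g.comp (inl K R S))
    (hr : f.comp (inr K R S) = g.comp (inr K R S)) : f = g := by
  apply (LinearAlgebra.FreeProduct.lift K (Pair R S)).symm.injective
  funext i
  cases i with
  | false => exact AlgHom.ext fun r => DFunLike.congr_fun hl r.down
  | true => exact AlgHom.ext fun s => DFunLike.congr_fun hr s.down

end Coprod

/-! ### Systems of relations in an arbitrary target algebra -/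

section

variable {K A Ω X Y F F' : Type*} [Field K] [Ring A] [Algebra K A]
  [AddCommGroup Ω] [Module K Ω] [Module A Ω] [Module Aᵐᵒᵖ Ω]
  [AddCommGroup X] [Module K X] [Module A X] [Module Aᵐᵒᵖ X]
  [AddCommGroup Y] [Module K Y] [Module A Y] [Module Aᵐᵒᵖ Y]
  [Ring F] [Algebra K F] [Ring F'] [Algebra K F']

/-- The relations of `T𝔛` hold for maps `s`, `v` into an algebra. -/
structure ConnEqs (D : Calculus K A Ω) (P : LeftPairing K A Ω X)
    (s : A →ₐ[K] F) (v : X →ₗ[K] F) : Prop where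
  left : ∀ a x, s a * v x = v (a • x)
  right : ∀ a x, v x * s a = v (op a • x) + s (P.ev x (D.d a))

/-- The relations of `B𝔛` hold for maps `s`, `t`, `v`, `p` into an algebra. -/
structure BXEqs (D : Calculus K A Ω) (P : LeftPairing K A Ω X)
    (s : A →ₐ[K] F) (t : Aᵐᵒᵖ →ₐ[K] F) (v : X →ₗ[K] F) (p : X ⊗[K] Ω →ₗ[K] F) : Prop extends
    ConnEqs D P s v where
  comm : ∀ a b, s a * t b = t b * s a
  bar : ∀ a x, v x * t (op a) = t (op a) * v x + p (x ⊗ₜ D.d a)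
  s_mul_p : ∀ a x ξ, s a * p (x ⊗ₜ ξ) = p ((a • x) ⊗ₜ ξ)
  t_mul_p : ∀ a x ξ, t (op a) * p (x ⊗ₜ ξ) = p (x ⊗ₜ (op a • ξ))
  p_mul_s : ∀ a x ξ, p (x ⊗ₜ ξ) * s a = p ((op a • x) ⊗ₜ ξ)
  p_mul_t : ∀ a x ξ, p (x ⊗ₜ ξ) * t (op a) = p (x ⊗ₜ (a • ξ))

/-- The relations of `IB𝔛` hold for maps `s`, `t`, `v`, `p`, `q` into an algebra. -/
structure IBXEqs (D : Calculus K A Ω) (P : LeftPairing K A Ω X) (Q : RightPairing K A Ω Y)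
    {n m : ℕ} (ω : Fin n → Ω) (x : Fin n → X) (y : Fin m → Y) (ρ : Fin m → Ω)
    (s : A →ₐ[K] F) (t : Aᵐᵒᵖ →ₐ[K] F) (v : X →ₗ[K] F) (p : X ⊗[K] Ω →ₗ[K] F)
    (q : Ω ⊗[K] Y →ₗ[K] F) : Prop extends BXEqs D P s t v p where
  s_mul_q : ∀ a ξ z, s a * q (ξ ⊗ₜ z) = q ((a • ξ) ⊗ₜ z)
  t_mul_q : ∀ a ξ z, t (op a) * q (ξ ⊗ₜ z) = q (ξ ⊗ₜ (op a • z))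
  q_mul_s : ∀ a ξ z, q (ξ ⊗ₜ z) * s a = q ((op a • ξ) ⊗ₜ z)
  q_mul_t : ∀ a ξ z, q (ξ ⊗ₜ z) * t (op a) = q (ξ ⊗ₜ (a • z))
  inv₁ : ∀ ξ z, ∑ i, q (ω i ⊗ₜ z) * p (x i ⊗ₜ ξ) = t (op (Q.ev ξ z))
  inv₂ : ∀ z ξ, ∑ j, p (z ⊗ₜ ρ j) * q (ξ ⊗ₜ y j) = s (P.ev z ξ)

/-- The relations of the second presentation of `B𝔛` hold for maps `s`, `t`, `v` into an
algebra. -/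
structure SurjBXEqs [IsScalarTower K Aᵐᵒᵖ Ω] (D : Calculus K A Ω) (P : LeftPairing K A Ω X)
    (s : A →ₐ[K] F) (t : Aᵐᵒᵖ →ₐ[K] F) (v : X →ₗ[K] F) : Prop extends
    ConnEqs D P s v where
  comm : ∀ a b, s a * t b = t b * s a
  surj : ∀ {n : ℕ} (r r' : Fin n → A) (x : X), ∑ m, r m ⊗ₜ[K] r' m ∈ D.N →
    ∑ m, t (op (r' m)) * v x * t (op (r m)) = 0

/-- The relations of the second presentation of `IB𝔛` hold for maps `s`, `t`, `v`, `u` into an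
algebra. -/
structure SurjIBXEqs [IsScalarTower K Aᵐᵒᵖ Ω] (D : Calculus K A Ω) (P : LeftPairing K A Ω X)
    (Q : RightPairing K A Ω Y) {k l : ℕ} (b : Fin k → A) (x : Fin k → X) (y : Fin l → Y)
    (c : Fin l → A) (s : A →ₐ[K] F) (t : Aᵐᵒᵖ →ₐ[K] F) (v : X →ₗ[K] F) (u : Y →ₗ[K] F) :
    Prop extends SurjBXEqs D P s t v where
  t_mul_u : ∀ a z, t (op a) * u z = u (op a • z)
  u_mul_t : ∀ a z, u z * t (op a) = u (a • z) + t (op (Q.ev (D.d a) z))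
  surj_u : ∀ {n : ℕ} (r r' : Fin n → A) (z : Y), ∑ m, r m ⊗ₜ[K] r' m ∈ D.N →
    ∑ m, s (r m) * u z * s (r' m) = 0
  inv₁ : ∀ z, ∑ i, (u z * s (b i) - s (b i) * u z) * v (x i) = u z
  inv₂ : ∀ z, ∑ j, (v z * t (op (c j)) - t (op (c j)) * v z) * u (y j) = v z

/-- The algebra map on `Aᵉ` given by commuting maps on `A` and `Aᵐᵒᵖ`. -/
def liftEnv (s : A →ₐ[K] F) (t : Aᵐᵒᵖ →ₐ[K] F) (h : ∀ a b, s a * t b = t b * s a) :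
    A ⊗[K] Aᵐᵒᵖ →ₐ[K] F :=
  Algebra.TensorProduct.lift s t h

@[simp]
theorem liftEnv_tmul (s : A →ₐ[K] F) (t : Aᵐᵒᵖ →ₐ[K] F) (h : ∀ a b, s a * t b = t b * s a)
    (a a') : liftEnv s t h (a ⊗ₜ a') = s a * t a' :=
  Algebra.TensorProduct.lift_tmul s t h a a'

/-- The map from the free algebra on the generators of `B𝔛`. -/
def BXFree.lift (e : A ⊗[K] Aᵐᵒᵖ →ₐ[K] F) (v : X →ₗ[K] F) (p : X ⊗[K] Ω →ₗ[K] F) :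
    BXFree K A Ω X →ₐ[K] F :=
  Coprod.lift (Coprod.lift e (TensorAlgebra.lift K v)) (TensorAlgebra.lift K p)

/-- The map from the free algebra on the generators of `IB𝔛`. -/
def IBXFree.lift (e : A ⊗[K] Aᵐᵒᵖ →ₐ[K] F) (v : X →ₗ[K] F) (p : X ⊗[K] Ω →ₗ[K] F)
    (q : Ω ⊗[K] Y →ₗ[K] F) : IBXFree K A Ω X Y →ₐ[K] F :=
  Coprod.lift (BXFree.lift e v p) (TensorAlgebra.lift K q)

section BX

variable {D : Calculus K A Ω} {P : LeftPairing K A Ω X}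
  {s : A →ₐ[K] F} {t : Aᵐᵒᵖ →ₐ[K] F} {v : X →ₗ[K] F} {p : X ⊗[K] Ω →ₗ[K] F}
  {F₀ : Type*} [Ring F₀] [Algebra K F₀]

theorem ConnEqs.map_eq (h : ConnEqs D P s v) (φ : F₀ →ₐ[K] F) {s₀ : A → F₀} {v₀ : X → F₀}
    (hs : ∀ a, φ (s₀ a) = s a) (hv : ∀ x, φ (v₀ x) = v x) {f g : F₀}
    (r : ConnRel D P s₀ v₀ f g) : φ f = φ g := by
  cases r with
  | left a x => simp [hs, hv, h.left]
  | right a x => simp [hs, hv, h.right]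

theorem ConnEqs.map (h : ConnEqs D P s v) (φ : F →ₐ[K] F') :
    ConnEqs D P (φ.comp s) (φ.toLinearMap ∘ₗ v) where
  left a x := by simpa using congrArg φ (h.left a x)
  right a x := by simpa using congrArg φ (h.right a x)

theorem ConnEqs.of_rel {s₀ : A →ₐ[K] F₀} {v₀ : X →ₗ[K] F₀} {π : F₀ →ₐ[K] F}
    (H : ∀ {f g}, ConnRel D P s₀ v₀ f g → π f = π g) :
    ConnEqs D P (π.comp s₀) (π.toLinearMap ∘ₗ v₀) where
  left a x := by simpa using H (.left a x)
  right a x := by simpa using H (.right a x)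

/-- Four one-sided action laws recombine into the two-sided relation of the presentation; the
one-sided laws are the form in which all later computations are done. -/
theorem BXEqs.act (h : BXEqs D P s t v p) (a a' b b' : A) (x : X) (ξ : Ω) :
    s a * t (op a') * p (x ⊗ₜ ξ) * (s b * t (op b')) =
      p ((a • op b • x) ⊗ₜ (b' • op a' • ξ)) := by
  rw [mul_assoc (s a), h.t_mul_p, mul_assoc, ← mul_assoc (p _), h.p_mul_s, h.p_mul_t, h.s_mul_p]

theorem BXEqs.map_eq (h : BXEqs D P s t v p) (φ : F₀ →ₐ[K] F) {e₀ : A ⊗[K] Aᵐᵒᵖ → F₀}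
    {v₀ : X → F₀} {p₀ : X ⊗[K] Ω → F₀} (he : ∀ a a', φ (e₀ (a ⊗ₜ a')) = s a * t a')
    (hv : ∀ x, φ (v₀ x) = v x) (hp : ∀ x, φ (p₀ x) = p x) {f g : F₀}
    (r : BXRel D P e₀ v₀ p₀ f g) : φ f = φ g := by
  cases r with
  | conn r => exact h.toConnEqs.map_eq φ (by simp [he]) hv r
  | bar a x => simp [he, hv, hp, h.bar]
  | act a a' b b' x ξ => simp [he, hp, h.act]

/-- Converse to `BXEqs.map_eq`: the universal maps into a quotient satisfy the relations. Each
one-sided law is the two-sided one with the other three coefficients equal to `1`. -/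
theorem BXEqs.of_rel {e₀ : A ⊗[K] Aᵐᵒᵖ →ₐ[K] F₀} {v₀ : X →ₗ[K] F₀} {p₀ : X ⊗[K] Ω →ₗ[K] F₀}
    {π : F₀ →ₐ[K] F} (H : ∀ {f g}, BXRel D P e₀ v₀ p₀ f g → π f = π g) :
    BXEqs D P ((π.comp e₀).comp Algebra.TensorProduct.includeLeft)
      ((π.comp e₀).comp Algebra.TensorProduct.includeRight)
      (π.toLinearMap ∘ₗ v₀) (π.toLinearMap ∘ₗ p₀) where
  left a x := by simpa using H (.conn (.left a x))
  right a x := by simpa using H (.conn (.right a x))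
  comm a b := by simp [← map_mul]
  bar a x := by simpa using H (.bar a x)
  s_mul_p a x ξ := by
    simpa [← Algebra.TensorProduct.one_def] using H (.act a 1 1 1 x ξ)
  t_mul_p a x ξ := by
    simpa [← Algebra.TensorProduct.one_def] using H (.act 1 a 1 1 x ξ)
  p_mul_s a x ξ := by
    simpa [← Algebra.TensorProduct.one_def] using H (.act 1 1 a 1 x ξ)
  p_mul_t a x ξ := by
    simpa [← Algebra.TensorProduct.one_def] using H (.act 1 1 1 a x ξ)

variable (D P) in
/-- The map `A → B𝔛`. -/
def BX.ofA : A →ₐ[K] BX D P := (BX.e D P).comp Algebra.TensorProduct.includeLeft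

variable (D P) in
/-- The map `Aᵐᵒᵖ → B𝔛`. -/
def BX.ofOp : Aᵐᵒᵖ →ₐ[K] BX D P := (BX.e D P).comp Algebra.TensorProduct.includeRight

theorem BX.eqs : BXEqs (F := BX D P) D P (BX.ofA D P) (BX.ofOp D P) (BX.v D P) (BX.p D P) :=
  BXEqs.of_rel fun r => RingQuot.mkAlgHom_rel K r

/-- The universal property of `B𝔛`. -/
def BX.lift (h : BXEqs D P s t v p) : BX D P →ₐ[K] F :=
  RingQuot.liftAlgHom K ⟨BXFree.lift (liftEnv s t h.comm) v p, fun _ _ r =>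
    h.map_eq _ (by simp [BXFree.lift, BXFree.e]) (by simp [BXFree.lift, BXFree.v])
      (by simp [BXFree.lift, BXFree.p]) r⟩

@[simp]
theorem BX.lift_e (h : BXEqs D P s t v p) (a a') : BX.lift h (BX.e D P (a ⊗ₜ a')) = s a * t a' := by
  simp [BX.lift, BX.e, BXFree.lift, BXFree.e]

@[simp]
theorem BX.lift_v (h : BXEqs D P s t v p) (x) : BX.lift h (BX.v D P x) = v x := by
  simp [BX.lift, BX.v, BXFree.lift, BXFree.v]

@[simp]
theorem BX.lift_p (h : BXEqs D P s t v p) (x) : BX.lift h (BX.p D P x) = p x := by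
  simp [BX.lift, BX.p, BXFree.lift, BXFree.p]

@[simp]
theorem BX.lift_ofA (h : BXEqs D P s t v p) (a) : BX.lift h (BX.ofA D P a) = s a := by
  simp [BX.ofA]

@[simp]
theorem BX.lift_ofOp (h : BXEqs D P s t v p) (a) : BX.lift h (BX.ofOp D P a) = t a := by
  simp [BX.ofOp]

theorem BX.algHom_ext {B : Type*} [Semiring B] [Algebra K B]
    {f g : BX D P →ₐ[K] B} (hs : ∀ a, f (BX.ofA D P a) = g (BX.ofA D P a))
    (ht : ∀ a, f (BX.ofOp D P a) = g (BX.ofOp D P a)) (hv : ∀ x, f (BX.v D P x) = g (BX.v D P x))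
    (hp : ∀ x ξ, f (BX.p D P (x ⊗ₜ ξ)) = g (BX.p D P (x ⊗ₜ ξ))) : f = g := by
  refine RingQuot.ringQuot_ext' _ _ _ (Coprod.algHom_ext (Coprod.algHom_ext ?_ ?_) ?_)
  · exact Algebra.TensorProduct.ext (AlgHom.ext hs) (AlgHom.ext ht)
  · exact TensorAlgebra.hom_ext (LinearMap.ext hv)
  · exact TensorAlgebra.hom_ext (TensorProduct.ext' hp)

end BX

section IBX

variable {D : Calculus K A Ω} {P : LeftPairing K A Ω X} {Q : RightPairing K A Ω Y}
  {n m : ℕ} {ω : Fin n → Ω} {x : Fin n → X} {y : Fin m → Y} {ρ : Fin m → Ω}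
  {s : A →ₐ[K] F} {t : Aᵐᵒᵖ →ₐ[K] F} {v : X →ₗ[K] F} {p : X ⊗[K] Ω →ₗ[K] F}
  {q : Ω ⊗[K] Y →ₗ[K] F} {F₀ : Type*} [Ring F₀] [Algebra K F₀]

theorem IBXEqs.act (h : IBXEqs D P Q ω x y ρ s t v p q) (a a' b b' : A) (ξ : Ω) (z : Y) :
    s a * t (op a') * q (ξ ⊗ₜ z) * (s b * t (op b')) =
      q ((a • op b • ξ) ⊗ₜ (b' • op a' • z)) := by
  rw [mul_assoc (s a), h.t_mul_q, mul_assoc, ← mul_assoc (q _), h.q_mul_s, h.q_mul_t, h.s_mul_q]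

variable (D P Q ω x y ρ) in
/-- The map `A → IB𝔛`. -/
def IBX.ofA : A →ₐ[K] IBX D P Q ω x y ρ :=
  (IBX.e D P Q ω x y ρ).comp Algebra.TensorProduct.includeLeft

variable (D P Q ω x y ρ) in
/-- The map `Aᵐᵒᵖ → IB𝔛`. -/
def IBX.ofOp : Aᵐᵒᵖ →ₐ[K] IBX D P Q ω x y ρ :=
  (IBX.e D P Q ω x y ρ).comp Algebra.TensorProduct.includeRight

theorem IBXEqs.of_rel {e₀ : A ⊗[K] Aᵐᵒᵖ →ₐ[K] F₀} {v₀ : X →ₗ[K] F₀} {p₀ : X ⊗[K] Ω →ₗ[K] F₀}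
    {q₀ : Ω ⊗[K] Y →ₗ[K] F₀} {π : F₀ →ₐ[K] F}
    (H : ∀ {f g}, IBXRel D P Q ω x y ρ e₀ v₀ p₀ q₀ f g → π f = π g) :
    IBXEqs D P Q ω x y ρ ((π.comp e₀).comp Algebra.TensorProduct.includeLeft)
      ((π.comp e₀).comp Algebra.TensorProduct.includeRight)
      (π.toLinearMap ∘ₗ v₀) (π.toLinearMap ∘ₗ p₀) (π.toLinearMap ∘ₗ q₀) where
  toBXEqs := BXEqs.of_rel fun r => H (.base r)
  s_mul_q a ξ z := by
    simpa [← Algebra.TensorProduct.one_def] using H (.act a 1 1 1 ξ z)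
  t_mul_q a ξ z := by
    simpa [← Algebra.TensorProduct.one_def] using H (.act 1 a 1 1 ξ z)
  q_mul_s a ξ z := by
    simpa [← Algebra.TensorProduct.one_def] using H (.act 1 1 a 1 ξ z)
  q_mul_t a ξ z := by
    simpa [← Algebra.TensorProduct.one_def] using H (.act 1 1 1 a ξ z)
  inv₁ ξ z := by simpa using H (.inv₁ ξ z)
  inv₂ z ξ := by simpa using H (.inv₂ z ξ)

theorem IBX.eqs : IBXEqs (F := IBX D P Q ω x y ρ) D P Q ω x y ρ (IBX.ofA D P Q ω x y ρ)
    (IBX.ofOp D P Q ω x y ρ) (IBX.v D P Q ω x y ρ) (IBX.p D P Q ω x y ρ)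
    (IBX.q D P Q ω x y ρ) :=
  IBXEqs.of_rel fun r => RingQuot.mkAlgHom_rel K r

theorem IBXEqs.map_eq (h : IBXEqs D P Q ω x y ρ s t v p q) (φ : F₀ →ₐ[K] F)
    {e₀ : A ⊗[K] Aᵐᵒᵖ → F₀} {v₀ : X → F₀} {p₀ : X ⊗[K] Ω → F₀} {q₀ : Ω ⊗[K] Y → F₀}
    (he : ∀ a a', φ (e₀ (a ⊗ₜ a')) = s a * t a') (hv : ∀ x, φ (v₀ x) = v x)
    (hp : ∀ x, φ (p₀ x) = p x) (hq : ∀ x, φ (q₀ x) = q x) {f g : F₀}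
    (r : IBXRel D P Q ω x y ρ e₀ v₀ p₀ q₀ f g) : φ f = φ g := by
  cases r with
  | base r => exact h.toBXEqs.map_eq φ he hv hp r
  | act a a' b b' ξ z => simp [he, hq, h.act]
  | inv₁ ξ z => simp [he, hp, hq, h.inv₁]
  | inv₂ z ξ => simp [he, hp, hq, h.inv₂]

/-- The universal property of `IB𝔛`. -/
def IBX.lift (h : IBXEqs D P Q ω x y ρ s t v p q) : IBX D P Q ω x y ρ →ₐ[K] F :=
  RingQuot.liftAlgHom K ⟨IBXFree.lift (liftEnv s t h.comm) v p q, fun _ _ r =>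
    h.map_eq _ (by simp [IBXFree.lift, BXFree.lift, IBXFree.e, BXFree.e])
      (by simp [IBXFree.lift, BXFree.lift, IBXFree.v, BXFree.v])
      (by simp [IBXFree.lift, BXFree.lift, IBXFree.p, BXFree.p])
      (by simp [IBXFree.lift, IBXFree.q]) r⟩

variable (h : IBXEqs D P Q ω x y ρ s t v p q)

@[simp]
theorem IBX.lift_e (a a') : IBX.lift h (IBX.e D P Q ω x y ρ (a ⊗ₜ a')) = s a * t a' := by
  simp [IBX.lift, IBX.e, IBXFree.lift, BXFree.lift, IBXFree.e, BXFree.e]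

@[simp]
theorem IBX.lift_v (z) : IBX.lift h (IBX.v D P Q ω x y ρ z) = v z := by
  simp [IBX.lift, IBX.v, IBXFree.lift, BXFree.lift, IBXFree.v, BXFree.v]

@[simp]
theorem IBX.lift_p (z) : IBX.lift h (IBX.p D P Q ω x y ρ z) = p z := by
  simp [IBX.lift, IBX.p, IBXFree.lift, BXFree.lift, IBXFree.p, BXFree.p]

@[simp]
theorem IBX.lift_q (z) : IBX.lift h (IBX.q D P Q ω x y ρ z) = q z := by
  simp [IBX.lift, IBX.q, IBXFree.lift, IBXFree.q]

@[simp]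
theorem IBX.lift_ofA (a) : IBX.lift h (IBX.ofA D P Q ω x y ρ a) = s a := by
  simp [IBX.ofA]

@[simp]
theorem IBX.lift_ofOp (a) : IBX.lift h (IBX.ofOp D P Q ω x y ρ a) = t a := by
  simp [IBX.ofOp]

theorem IBX.algHom_ext {B : Type*} [Semiring B] [Algebra K B]
    {f g : IBX D P Q ω x y ρ →ₐ[K] B}
    (hs : ∀ a, f (IBX.ofA D P Q ω x y ρ a) = g (IBX.ofA D P Q ω x y ρ a))
    (ht : ∀ a, f (IBX.ofOp D P Q ω x y ρ a) = g (IBX.ofOp D P Q ω x y ρ a))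
    (hv : ∀ z, f (IBX.v D P Q ω x y ρ z) = g (IBX.v D P Q ω x y ρ z))
    (hp : ∀ z ξ, f (IBX.p D P Q ω x y ρ (z ⊗ₜ ξ)) = g (IBX.p D P Q ω x y ρ (z ⊗ₜ ξ)))
    (hq : ∀ ξ z, f (IBX.q D P Q ω x y ρ (ξ ⊗ₜ z)) = g (IBX.q D P Q ω x y ρ (ξ ⊗ₜ z))) :
    f = g := by
  refine RingQuot.ringQuot_ext' _ _ _ (Coprod.algHom_ext
    (Coprod.algHom_ext (Coprod.algHom_ext ?_ ?_) ?_) ?_)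
  · exact Algebra.TensorProduct.ext (AlgHom.ext hs) (AlgHom.ext ht)
  · exact TensorAlgebra.hom_ext (LinearMap.ext hv)
  · exact TensorAlgebra.hom_ext (TensorProduct.ext' hp)
  · exact TensorAlgebra.hom_ext (TensorProduct.ext' hq)

end IBX

/-! ### Universal properties of the second presentations -/

section SurjBX

variable {D : Calculus K A Ω} {P : LeftPairing K A Ω X} {s : A →ₐ[K] F} {v : X →ₗ[K] F}

theorem TX.eqs : ConnEqs (F := TX D P) D P (TX.s D P) (TX.v D P) :=
  ConnEqs.of_rel (v₀ := (Coprod.inr K A (TensorAlgebra K X)).toLinearMap ∘ₗ TensorAlgebra.ι K)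
    fun r => RingQuot.mkAlgHom_rel K r

/-- The universal property of `T𝔛`. -/
def TX.lift (h : ConnEqs D P s v) : TX D P →ₐ[K] F :=
  RingQuot.liftAlgHom K ⟨Coprod.lift s (TensorAlgebra.lift K v), fun _ _ r =>
    h.map_eq _ (by simp) (by simp) r⟩

@[simp]
theorem TX.lift_s (h : ConnEqs D P s v) (a) : TX.lift h (TX.s D P a) = s a := by
  simp [TX.lift, TX.s]

@[simp]
theorem TX.lift_v (h : ConnEqs D P s v) (x) : TX.lift h (TX.v D P x) = v x := by
  simp [TX.lift, TX.v]

theorem TX.algHom_ext {B : Type*} [Semiring B] [Algebra K B]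
    {f g : TX D P →ₐ[K] B} (hs : ∀ a, f (TX.s D P a) = g (TX.s D P a))
    (hv : ∀ x, f (TX.v D P x) = g (TX.v D P x)) : f = g :=
  RingQuot.ringQuot_ext' _ _ _ (Coprod.algHom_ext (AlgHom.ext hs)
    (TensorAlgebra.hom_ext (LinearMap.ext hv)))

variable [IsScalarTower K Aᵐᵒᵖ Ω] {t : Aᵐᵒᵖ →ₐ[K] F}

/-- The presentation has two stages: the relations of `T𝔛` already hold before this quotient is
taken and are only transported along `π`. -/
theorem SurjBXEqs.of_rel {F₀ : Type*} [Ring F₀] [Algebra K F₀] {s₀ : A →ₐ[K] F₀}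
    {t₀ : Aᵐᵒᵖ →ₐ[K] F₀} {v₀ : X →ₗ[K] F₀} {π : F₀ →ₐ[K] F} (h : ConnEqs D P s₀ v₀)
    (H : ∀ {f g}, SurjBXRel D t₀ s₀ v₀ f g → π f = π g) :
    SurjBXEqs D P (π.comp s₀) (π.comp t₀) (π.toLinearMap ∘ₗ v₀) where
  toConnEqs := h.map π
  comm a b := by simpa using H (.comm a b.unop)
  surj r r' x h := by simpa using H (.surj r r' x h)

theorem SurjBX.eqs :
    SurjBXEqs (F := SurjBX D P) D P (SurjBX.s D P) (SurjBX.t D P) (SurjBX.v D P) :=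
  SurjBXEqs.of_rel (TX.eqs.map (Coprod.inr K Aᵐᵒᵖ (TX D P)))
    fun r => RingQuot.mkAlgHom_rel K r

/-- The universal property of the second presentation of `B𝔛`. -/
def SurjBX.lift (h : SurjBXEqs D P s t v) : SurjBX D P →ₐ[K] F :=
  RingQuot.liftAlgHom K ⟨Coprod.lift t (TX.lift h.toConnEqs), fun _ _ r => by
    cases r with
    | comm a b => simp [h.comm]
    | surj r r' x hr => simp [h.surj _ _ _ hr]⟩

@[simp]
theorem SurjBX.lift_s (h : SurjBXEqs D P s t v) (a) : SurjBX.lift h (SurjBX.s D P a) = s a := by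
  simp [SurjBX.lift, SurjBX.s]

@[simp]
theorem SurjBX.lift_t (h : SurjBXEqs D P s t v) (a) : SurjBX.lift h (SurjBX.t D P a) = t a := by
  simp [SurjBX.lift, SurjBX.t]

@[simp]
theorem SurjBX.lift_v (h : SurjBXEqs D P s t v) (x) : SurjBX.lift h (SurjBX.v D P x) = v x := by
  simp [SurjBX.lift, SurjBX.v]

theorem SurjBX.algHom_ext {B : Type*} [Semiring B] [Algebra K B]
    {f g : SurjBX D P →ₐ[K] B}
    (hs : ∀ a, f (SurjBX.s D P a) = g (SurjBX.s D P a))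
    (ht : ∀ a, f (SurjBX.t D P a) = g (SurjBX.t D P a))
    (hv : ∀ x, f (SurjBX.v D P x) = g (SurjBX.v D P x)) : f = g :=
  RingQuot.ringQuot_ext' _ _ _ (Coprod.algHom_ext (AlgHom.ext ht) (TX.algHom_ext hs hv))

end SurjBX

section SurjIBX

variable [IsScalarTower K Aᵐᵒᵖ Ω] {D : Calculus K A Ω} {P : LeftPairing K A Ω X}
  {Q : RightPairing K A Ω Y} {k l : ℕ} {b : Fin k → A} {x : Fin k → X} {y : Fin l → Y}
  {c : Fin l → A} {s : A →ₐ[K] F} {t : Aᵐᵒᵖ →ₐ[K] F} {v : X →ₗ[K] F} {u : Y →ₗ[K] F}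

theorem SurjBXEqs.map (h : SurjBXEqs D P s t v) (φ : F →ₐ[K] F') :
    SurjBXEqs D P (φ.comp s) (φ.comp t) (φ.toLinearMap ∘ₗ v) where
  toConnEqs := h.toConnEqs.map φ
  comm a b := by simpa using congrArg φ (h.comm a b)
  surj r r' x hr := by simpa using congrArg φ (h.surj r r' x hr)

theorem SurjIBXEqs.of_rel {F₀ : Type*} [Ring F₀] [Algebra K F₀] {s₀ : A →ₐ[K] F₀}
    {t₀ : Aᵐᵒᵖ →ₐ[K] F₀} {v₀ : X →ₗ[K] F₀} {u₀ : Y →ₗ[K] F₀} {π : F₀ →ₐ[K] F}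
    (h : SurjBXEqs D P s₀ t₀ v₀)
    (H : ∀ {f g}, SurjIBXRel D Q b x y c t₀ s₀ v₀ u₀ f g → π f = π g) :
    SurjIBXEqs D P Q b x y c (π.comp s₀) (π.comp t₀) (π.toLinearMap ∘ₗ v₀)
      (π.toLinearMap ∘ₗ u₀) where
  toSurjBXEqs := h.map π
  t_mul_u a z := by simpa using H (.left a z)
  u_mul_t a z := by simpa using H (.right a z)
  surj_u r r' z h := by simpa using H (.surj r r' z h)
  inv₁ z := by simpa using H (.inv₁ z)
  inv₂ z := by simpa using H (.inv₂ z)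

theorem SurjIBX.eqs : SurjIBXEqs (F := SurjIBX D P Q b x y c) D P Q b x y c
    (SurjIBX.s D P Q b x y c) (SurjIBX.t D P Q b x y c) (SurjIBX.v D P Q b x y c)
    (SurjIBX.u D P Q b x y c) := by
  have h : SurjBXEqs D P _ _ _ := SurjBX.eqs.map (Coprod.inl K (SurjBX D P) (TensorAlgebra K Y))
  exact SurjIBXEqs.of_rel (F := SurjIBX D P Q b x y c)
    (F₀ := Coprod K (SurjBX D P) (TensorAlgebra K Y)) (Q := Q) (b := b) (x := x) (y := y) (c := c)
    (π := RingQuot.mkAlgHom K (SurjIBXr D P Q b x y c))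
    (u₀ := (Coprod.inr K (SurjBX D P) (TensorAlgebra K Y)).toLinearMap ∘ₗ TensorAlgebra.ι K)
    h fun r => RingQuot.mkAlgHom_rel K r

/-- The universal property of the second presentation of `IB𝔛`. -/
def SurjIBX.lift (h : SurjIBXEqs D P Q b x y c s t v u) : SurjIBX D P Q b x y c →ₐ[K] F :=
  RingQuot.liftAlgHom K
    ⟨Coprod.lift (SurjBX.lift h.toSurjBXEqs) (TensorAlgebra.lift K u), fun _ _ r => by
      cases r with
      | left a z => simp [h.t_mul_u]
      | right a z => simp [h.u_mul_t]
      | surj r r' z hr => simp [h.surj_u _ _ _ hr]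
      | inv₁ z => simp [h.inv₁]
      | inv₂ z => simp [h.inv₂]⟩

variable (h : SurjIBXEqs D P Q b x y c s t v u)

@[simp]
theorem SurjIBX.lift_s (a) : SurjIBX.lift h (SurjIBX.s D P Q b x y c a) = s a := by
  simp [SurjIBX.lift, SurjIBX.s, SurjIBX.ofBX]

@[simp]
theorem SurjIBX.lift_t (a) : SurjIBX.lift h (SurjIBX.t D P Q b x y c a) = t a := by
  simp [SurjIBX.lift, SurjIBX.t, SurjIBX.ofBX]

@[simp]
theorem SurjIBX.lift_v (z) : SurjIBX.lift h (SurjIBX.v D P Q b x y c z) = v z := by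
  simp [SurjIBX.lift, SurjIBX.v, SurjIBX.ofBX]

@[simp]
theorem SurjIBX.lift_u (z) : SurjIBX.lift h (SurjIBX.u D P Q b x y c z) = u z := by
  simp [SurjIBX.lift, SurjIBX.u]

theorem SurjIBX.algHom_ext {B : Type*} [Semiring B] [Algebra K B]
    {f g : SurjIBX D P Q b x y c →ₐ[K] B}
    (hs : ∀ a, f (SurjIBX.s D P Q b x y c a) = g (SurjIBX.s D P Q b x y c a))
    (ht : ∀ a, f (SurjIBX.t D P Q b x y c a) = g (SurjIBX.t D P Q b x y c a))
    (hv : ∀ z, f (SurjIBX.v D P Q b x y c z) = g (SurjIBX.v D P Q b x y c z))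
    (hu : ∀ z, f (SurjIBX.u D P Q b x y c z) = g (SurjIBX.u D P Q b x y c z)) : f = g :=
  RingQuot.ringQuot_ext' _ _ _ (Coprod.algHom_ext (SurjBX.algHom_ext hs ht hv)
    (TensorAlgebra.hom_ext (LinearMap.ext hu)))

end SurjIBX

end

/-! ### Surjective calculi -/

namespace Calculus

variable {K A Ω : Type*} [Field K] [Ring A] [Algebra K A] [AddCommGroup Ω]
  [Module K Ω] [Module A Ω] [Module Aᵐᵒᵖ Ω] {D : Calculus K A Ω}

theorem op_smul_d (D : Calculus K A Ω) (a b : A) :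
    op b • D.d a = D.d (a * b) - a • D.d b := by
  simp [D.leibniz]

/-- No case for scalars is needed, as a scalar is absorbed into the coefficient `a` of `a db`. This
reduces every identity additive in a form to forms `a db`. -/
theorem IsSurjective.induction [IsScalarTower K A Ω] (hD : D.IsSurjective) {C : Ω → Prop}
    (smul_d : ∀ a b : A, C (a • D.d b)) (add : ∀ ξ η, C ξ → C η → C (ξ + η)) (ξ : Ω) : C ξ := by
  have hξ : ξ ∈ Submodule.span K {ξ : Ω | ∃ a b : A, ξ = a • D.d b} := by
    rw [show Submodule.span K _ = ⊤ from hD]; trivial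
  refine Submodule.closure_induction (p := fun ξ _ => C ξ) ?_ ?_ ?_ hξ
  · simpa using smul_d 0 0
  · exact fun ξ η _ _ => add ξ η
  · rintro c _ ⟨a, b, rfl⟩
    simpa using smul_d (c • a) b

variable [IsScalarTower K Aᵐᵒᵖ Ω]

theorem sum_tmul_mem_N {n : ℕ} (r r' : Fin n → A) :
    ∑ m, r m ⊗ₜ[K] r' m ∈ D.N ↔ ∑ m, r m * r' m = 0 ∧ ∑ m, op (r' m) • D.d (r m) = 0 := by
  simp [N, universalForms, fromUniversal]

/-- A linear map on `A ⊗ A` which vanishes on `𝒩` induces a map on `Ω`. -/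
theorem IsSurjective.exists_map {M : Type*} [AddCommGroup M] [Module K M]
    (hD : D.IsSurjective) (G : A ⊗[K] A →ₗ[K] M) (hG : ∀ u ∈ D.N, G u = 0) :
    ∃ f : Ω →ₗ[K] M, ∀ a b, f (a • D.d b) = G ((a * b) ⊗ₜ 1 - a ⊗ₜ b) := by
  let φ : universalForms K A →ₗ[K] Ω := D.fromUniversal.domRestrict _
  have hφ : LinearMap.range φ = ⊤ := by
    rw [← D.map_fromUniversal hD, LinearMap.range_domRestrict]
  -- Over a field the surjection `Ω_uni → Ω` has a linear section; composing `G` with it gives the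
  -- induced map.
  obtain ⟨g, hg⟩ := φ.exists_rightInverse_of_surjective hφ
  refine ⟨G ∘ₗ (universalForms K A).subtype ∘ₗ g, fun a b => ?_⟩
  let w : universalForms K A := ⟨(a * b) ⊗ₜ 1 - a ⊗ₜ b, by simp [universalForms]⟩
  have hw : φ w = a • D.d b := by
    simp [φ, w, fromUniversal, D.leibniz]
  -- Lifting `φ w` back changes `w` by an element of the kernel, that is of `𝒩`, which `G` does not
  -- see.
  have h : G ((g (φ w) - w : universalForms K A) : A ⊗[K] A) = 0 := by
    refine hG _ ⟨Subtype.property _, ?_⟩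
    change φ (g (φ w) - w) = 0
    rw [map_sub, ← LinearMap.comp_apply φ g, hg, LinearMap.id_apply, sub_self]
  rw [hw] at h
  simpa [sub_eq_zero, w] using h

theorem IsSurjective.exists_eq_sum_op_smul (hD : D.IsSurjective) (ξ : Ω) :
    ∃ (n : ℕ) (a b : Fin n → A), ξ = ∑ i, op (a i) • D.d (b i) := by
  obtain ⟨u, -, rfl⟩ : ξ ∈ (universalForms K A).map D.fromUniversal := by
    rw [D.map_fromUniversal hD]; trivial
  obtain ⟨n, b, a, rfl⟩ := TensorProduct.exists_sum_tmul_eq u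
  exact ⟨n, a, b, by simp [fromUniversal]⟩

theorem IsSurjective.exists_eq_sum_smul (hD : D.IsSurjective) (ξ : Ω) :
    ∃ (n : ℕ) (a b : Fin n → A), ξ = ∑ i, a i • D.d (b i) := by
  obtain ⟨u, hu, rfl⟩ : ξ ∈ (universalForms K A).map D.fromUniversal := by
    rw [D.map_fromUniversal hD]; trivial
  obtain ⟨n, b, a, rfl⟩ := TensorProduct.exists_sum_tmul_eq u
  -- On `Ω_uni` one has `∑ b_i a_i = 0`, so Leibniz turns `∑ (db_i) a_i` into `-∑ b_i da_i`; hence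
  -- the sign.
  refine ⟨n, fun i => -b i, a, ?_⟩
  have h : ∑ i, b i * a i = 0 := by simpa [universalForms] using hu
  have h' : ∑ i, D.d (b i * a i) = 0 := by rw [← map_sum, h, map_zero]
  rw [map_sum]
  simp [fromUniversal, op_smul_d, h']

end Calculus

/-! ### Coevaluations -/

section Coev

variable {K A Ω X Y : Type*} [Field K] [Ring A] [Algebra K A]
  [AddCommGroup Ω] [Module K Ω] [Module A Ω] [Module Aᵐᵒᵖ Ω]
  [AddCommGroup X] [Module K X] [Module A X] [Module Aᵐᵒᵖ X]
  [AddCommGroup Y] [Module K Y] [Module A Y] [Module Aᵐᵒᵖ Y]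
  {M : Type*} [AddCommGroup M] [Module K M]
  {D : Calculus K A Ω} {P : LeftPairing K A Ω X} {Q : RightPairing K A Ω Y}
  {n m : ℕ}

/-- Balanced maps agree on any two coevaluations. -/
theorem LeftPairing.IsCoev.sum_eq {ω : Fin n → Ω} {x : Fin n → X} {ω' : Fin m → Ω}
    {x' : Fin m → X} (h : P.IsCoev ω x) (h' : P.IsCoev ω' x') (f : Ω →ₗ[K] X →ₗ[K] M)
    (hf : ∀ (a : A) ξ z, f (op a • ξ) z = f ξ (a • z)) :
    ∑ i, f (ω i) (x i) = ∑ j, f (ω' j) (x' j) := by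
  -- Insert the second coevaluation into `ω_i` by its first triangle identity, move the coefficient
  -- across, and contract the first coevaluation by its second identity.
  calc ∑ i, f (ω i) (x i) = ∑ i, ∑ j, f (ω' j) (P.ev (x' j) (ω i) • x i) := by
        refine Finset.sum_congr rfl fun i _ => ?_
        conv_lhs => rw [← h'.1 (ω i)]
        simp [hf]
    _ = ∑ j, f (ω' j) (x' j) := by
        rw [Finset.sum_comm]
        refine Finset.sum_congr rfl fun j _ => ?_
        rw [← map_sum, h.2]

/-- A coevaluation is central. -/
theorem LeftPairing.IsCoev.sum_smul {ω : Fin n → Ω} {x : Fin n → X} (h : P.IsCoev ω x)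
    (f : Ω →ₗ[K] X →ₗ[K] M) (hf : ∀ (a : A) ξ z, f (op a • ξ) z = f ξ (a • z)) (a : A) :
    ∑ i, f (a • ω i) (x i) = ∑ i, f (ω i) (op a • x i) := by
  -- The same insertion and contraction, with both copies the given coevaluation; balancedness of
  -- `ev` carries `a` over to `x_j`.
  calc ∑ i, f (a • ω i) (x i) = ∑ i, ∑ j, f (ω j) (P.ev (op a • x j) (ω i) • x i) := by
        refine Finset.sum_congr rfl fun i _ => ?_
        conv_lhs => rw [← h.1 (a • ω i)]
        simp [hf, P.ev_balanced]
    _ = ∑ j, f (ω j) (op a • x j) := by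
        rw [Finset.sum_comm]
        refine Finset.sum_congr rfl fun j _ => ?_
        rw [← map_sum, h.2]

/-- Balanced maps agree on any two coevaluations. -/
theorem RightPairing.IsCoev.sum_eq {y : Fin n → Y} {ρ : Fin n → Ω} {y' : Fin m → Y}
    {ρ' : Fin m → Ω} (h : Q.IsCoev y ρ) (h' : Q.IsCoev y' ρ') (f : Y →ₗ[K] Ω →ₗ[K] M)
    (hf : ∀ (a : A) z ξ, f (op a • z) ξ = f z (a • ξ)) :
    ∑ i, f (y i) (ρ i) = ∑ j, f (y' j) (ρ' j) := by
  calc ∑ i, f (y i) (ρ i) = ∑ i, ∑ j, f (y' j) (Q.ev (ρ' j) (y i) • ρ i) := by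
        refine Finset.sum_congr rfl fun i _ => ?_
        conv_lhs => rw [← h'.2 (y i)]
        simp [hf]
    _ = ∑ j, f (y' j) (ρ' j) := by
        rw [Finset.sum_comm]
        refine Finset.sum_congr rfl fun j _ => ?_
        rw [← map_sum, h.1]

variable [IsScalarTower K Aᵐᵒᵖ Ω]

/-- Each `ω_i` is a sum of terms `(db) a`, and the coefficient `a` moves across `⊗_A` onto `x_i`.
This is why coefficients on the right of `db` are wanted here, and on the left for the right dual.
-/
theorem LeftPairing.IsCoev.exists_d {ω : Fin n → Ω} {x : Fin n → X} (h : P.IsCoev ω x)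
    (hD : D.IsSurjective) :
    ∃ (k : ℕ) (b : Fin k → A) (x' : Fin k → X), P.IsCoev (fun i => D.d (b i)) x' := by
  choose N a b hab using fun i => hD.exists_eq_sum_op_smul (ω i)
  let e := (Fintype.equivFin (Σ i, Fin (N i))).symm
  refine ⟨_, fun j => b (e j).1 (e j).2, fun j => a (e j).1 (e j).2 • x (e j).1,
    fun ξ => ?_, fun z => ?_⟩
  · rw [e.sum_comp fun j => op (P.ev (a j.1 j.2 • x j.1) ξ) • D.d (b j.1 j.2),
      Fintype.sum_sigma]
    conv_rhs => rw [← h.1 ξ]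
    refine Finset.sum_congr rfl fun i _ => ?_
    rw [hab i, Finset.smul_sum]
    simp [P.ev_smul, mul_smul]
  · rw [e.sum_comp fun j => P.ev z (D.d (b j.1 j.2)) • a j.1 j.2 • x j.1, Fintype.sum_sigma]
    conv_rhs => rw [← h.2 z]
    refine Finset.sum_congr rfl fun i _ => ?_
    rw [hab i, map_sum, Finset.sum_smul]
    simp [P.ev_op_smul, mul_smul]

theorem RightPairing.IsCoev.exists_d {y : Fin n → Y} {ρ : Fin n → Ω} (h : Q.IsCoev y ρ)
    (hD : D.IsSurjective) :
    ∃ (l : ℕ) (y' : Fin l → Y) (c : Fin l → A), Q.IsCoev y' (fun j => D.d (c j)) := by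
  choose N a b hab using fun i => hD.exists_eq_sum_smul (ρ i)
  let e := (Fintype.equivFin (Σ i, Fin (N i))).symm
  refine ⟨_, fun j => op (a (e j).1 (e j).2) • y (e j).1, fun j => b (e j).1 (e j).2,
    fun ξ => ?_, fun z => ?_⟩
  · rw [e.sum_comp fun j => Q.ev ξ (op (a j.1 j.2) • y j.1) • D.d (b j.1 j.2),
      Fintype.sum_sigma]
    conv_rhs => rw [← h.1 ξ]
    refine Finset.sum_congr rfl fun i _ => ?_
    rw [hab i, Finset.smul_sum]
    simp [Q.ev_op_smul, mul_smul]
  · rw [e.sum_comp fun j => op (Q.ev (D.d (b j.1 j.2)) z) • op (a j.1 j.2) • y j.1,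
      Fintype.sum_sigma]
    conv_rhs => rw [← h.2 z]
    refine Finset.sum_congr rfl fun i _ => ?_
    rw [hab i, map_sum, LinearMap.sum_apply, Finset.op_sum, Finset.sum_smul]
    simp [Q.ev_smul, mul_smul]

end Coev

/-! ### Comparison of the relations -/

section

variable {K A Ω X Y F : Type*} [Field K] [Ring A] [Algebra K A]
  [AddCommGroup Ω] [Module K Ω] [Module A Ω] [Module Aᵐᵒᵖ Ω]
  [IsScalarTower K A Ω] [IsScalarTower K Aᵐᵒᵖ Ω] [SMulCommClass A Aᵐᵒᵖ Ω]
  [AddCommGroup X] [Module K X] [Module A X] [Module Aᵐᵒᵖ X]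
  [AddCommGroup Y] [Module K Y] [Module A Y] [Module Aᵐᵒᵖ Y]
  [Ring F] [Algebra K F]
  {D : Calculus K A Ω} {P : LeftPairing K A Ω X} {Q : RightPairing K A Ω Y}
  {s : A →ₐ[K] F} {t : Aᵐᵒᵖ →ₐ[K] F} {v : X →ₗ[K] F} {p : X ⊗[K] Ω →ₗ[K] F}
  {q : Ω ⊗[K] Y →ₗ[K] F} {u : Y →ₗ[K] F}

omit [IsScalarTower K A Ω] [IsScalarTower K Aᵐᵒᵖ Ω] [SMulCommClass A Aᵐᵒᵖ Ω] in
theorem BXEqs.p_smul_d (h : BXEqs D P s t v p) (x : X) (a b : A) :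
    (v x * t (op b) - t (op b) * v x) * t (op a) = p (x ⊗ₜ (a • D.d b)) := by
  rw [h.bar, add_sub_cancel_left, h.p_mul_t]

omit [IsScalarTower K A Ω] [SMulCommClass A Aᵐᵒᵖ Ω] in
-- Moving `r̄_m` to the left of `x` produces one term with `∑ r_m s_m` and one with `∑ (dr_m) s_m`.
-- These are the two sums whose vanishing defines `𝒩`.
theorem BXEqs.toSurjBXEqs (h : BXEqs D P s t v p) : SurjBXEqs D P s t v where
  toConnEqs := h.toConnEqs
  comm := h.comm
  surj {n} r r' x hr := by
    rw [Calculus.sum_tmul_mem_N] at hr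
    calc ∑ m, t (op (r' m)) * v x * t (op (r m))
        = ∑ m, (t (op (r m * r' m)) * v x + p (x ⊗ₜ (op (r' m) • D.d (r m)))) := by
          refine Finset.sum_congr rfl fun m _ => ?_
          rw [mul_assoc, h.bar, mul_add, h.t_mul_p, ← mul_assoc, ← map_mul, MulOpposite.op_mul]
      _ = t (op (∑ m, r m * r' m)) * v x + p (x ⊗ₜ ∑ m, op (r' m) • D.d (r m)) := by
          simp only [Finset.sum_add_distrib, TensorProduct.tmul_sum, map_sum, Finset.op_sum,
            Finset.sum_mul]
      _ = 0 := by simp [hr.1, hr.2]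

omit [IsScalarTower K A Ω] [SMulCommClass A Aᵐᵒᵖ Ω] in
theorem SurjBXEqs.exists_p (h : SurjBXEqs D P s t v) (hD : D.IsSurjective) :
    ∃ p : X ⊗[K] Ω →ₗ[K] F, ∀ (x : X) (a b : A), p (x ⊗ₜ (a • D.d b)) =
      (v x * t (op b) - t (op b) * v x) * t (op a) := by
  let G : A ⊗[K] A →ₗ[K] X →ₗ[K] F := TensorProduct.lift (LinearMap.mk₂ K
    (fun r r' => (LinearMap.mulLeft K (t (op r')) ∘ₗ LinearMap.mulRight K (t (op r))) ∘ₗ v)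
    (fun _ _ _ => by ext; simp [mul_add]) (fun _ _ _ => by ext; simp)
    (fun _ _ _ => by ext; simp [add_mul]) (fun _ _ _ => by ext; simp))
  have hG (r r' : A) (x : X) : G (r ⊗ₜ r') x = t (op r') * (v x * t (op r)) := rfl
  obtain ⟨f, hf⟩ := hD.exists_map G fun w hw => by
    obtain ⟨n, r, r', rfl⟩ := TensorProduct.exists_sum_tmul_eq w
    ext x
    simpa [hG, mul_assoc] using h.surj r r' x hw
  refine ⟨TensorProduct.lift f.flip, fun x a b => ?_⟩
  rw [TensorProduct.lift.tmul, LinearMap.flip_apply, hf, map_sub, LinearMap.sub_apply, hG, hG]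
  simp only [MulOpposite.op_mul, MulOpposite.op_one, map_mul, map_one]
  noncomm_ring

/-- By surjectivity it suffices to check forms `g db`, where each law becomes a commutator identity.
-/
theorem SurjBXEqs.toBXEqs (h : SurjBXEqs D P s t v) (hD : D.IsSurjective)
    (hp : ∀ (x : X) (a b : A), p (x ⊗ₜ (a • D.d b)) =
      (v x * t (op b) - t (op b) * v x) * t (op a)) : BXEqs D P s t v p where
  toConnEqs := h.toConnEqs
  comm := h.comm
  bar a x := by
    have := hp x 1 a
    simp only [one_smul, MulOpposite.op_one, map_one, mul_one] at this
    rw [this]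
    abel
  s_mul_p a x ξ := by
    induction ξ using hD.induction with
    | smul_d g b =>
      rw [hp, hp, ← h.left, ← mul_assoc, mul_sub, ← mul_assoc, ← mul_assoc, h.comm, mul_assoc (t _)]
    | add ξ η hξ hη => simp only [TensorProduct.tmul_add, map_add, mul_add, hξ, hη]
  t_mul_p a x ξ := by
    induction ξ using hD.induction with
    | smul_d g b =>
      -- Leibniz rewrites `g (db) a` as `g d(ba) - gb da`, a combination of forms on which `p` is
      -- known.
      rw [← smul_comm, Calculus.op_smul_d, smul_sub, smul_smul, TensorProduct.tmul_sub, map_sub,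
        hp, hp, hp]
      simp only [MulOpposite.op_mul, map_mul]
      noncomm_ring
    | add ξ η hξ hη => simp only [TensorProduct.tmul_add, smul_add, map_add, mul_add, hξ, hη]
  p_mul_s a x ξ := by
    induction ξ using hD.induction with
    | smul_d g b =>
      -- The correction `ev(x, da)` lies in the image of `A`, which commutes with `b̄`, so it drops
      -- out of the commutator.
      rw [hp, hp, eq_sub_of_add_eq (h.right a x).symm, mul_assoc, ← h.comm, ← mul_assoc, sub_mul,
        mul_assoc (v x), ← h.comm, ← mul_assoc, sub_mul (v x * s a), h.comm (P.ev x (D.d a))]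
      noncomm_ring
    | add ξ η hξ hη => simp only [TensorProduct.tmul_add, map_add, add_mul, hξ, hη]
  p_mul_t a x ξ := by
    induction ξ using hD.induction with
    | smul_d g b => rw [smul_smul, hp, hp, MulOpposite.op_mul, map_mul, mul_assoc]
    | add ξ η hξ hη => simp only [TensorProduct.tmul_add, smul_add, map_add, add_mul, hξ, hη]

/-! ### Relations involving the right dual -/

section Inverse

variable {k l n m : ℕ} {b : Fin k → A} {x' : Fin k → X} {y' : Fin l → Y} {c : Fin l → A}
  {ω : Fin n → Ω} {x : Fin n → X} {y : Fin m → Y} {ρ : Fin m → Ω}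

omit [IsScalarTower K A Ω] [SMulCommClass A Aᵐᵒᵖ Ω] in
theorem SurjIBXEqs.exists_q (h : SurjIBXEqs D P Q b x' y' c s t v u) (hD : D.IsSurjective) :
    ∃ q : Ω ⊗[K] Y →ₗ[K] F, ∀ (a a' : A) (z : Y), q ((a • D.d a') ⊗ₜ z) =
      s a * (u z * s a' - s a' * u z) := by
  let G : A ⊗[K] A →ₗ[K] Y →ₗ[K] F := TensorProduct.lift (LinearMap.mk₂ K
    -- The sign makes the value at `ab ⊗ 1 - a ⊗ b` equal to `a • [ȳ, b]`.
    (fun r r' => -((LinearMap.mulLeft K (s r) ∘ₗ LinearMap.mulRight K (s r')) ∘ₗ u))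
    (fun _ _ _ => by ext; simp [add_mul, add_comm]) (fun _ _ _ => by ext; simp)
    (fun _ _ _ => by ext; simp [mul_add, add_comm]) (fun _ _ _ => by ext; simp))
  have hG (r r' : A) (z : Y) : G (r ⊗ₜ r') z = -(s r * (u z * s r')) := rfl
  obtain ⟨f, hf⟩ := hD.exists_map G fun w hw => by
    obtain ⟨n, r, r', rfl⟩ := TensorProduct.exists_sum_tmul_eq w
    ext z
    simpa [hG, mul_assoc] using h.surj_u r r' z hw
  refine ⟨TensorProduct.lift f, fun a a' z => ?_⟩
  rw [TensorProduct.lift.tmul, hf, map_sub, LinearMap.sub_apply, hG, hG]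
  simp only [map_mul, map_one]
  noncomm_ring

theorem SurjIBXEqs.toIBXEqs (h : SurjIBXEqs D P Q b x' y' c s t v u) (hD : D.IsSurjective)
    (hp : ∀ (x : X) (a b : A), p (x ⊗ₜ (a • D.d b)) =
      (v x * t (op b) - t (op b) * v x) * t (op a))
    (hq : ∀ (a a' : A) (z : Y), q ((a • D.d a') ⊗ₜ z) = s a * (u z * s a' - s a' * u z)) :
    IBXEqs D P Q (fun i => D.d (b i)) x' y' (fun j => D.d (c j)) s t v p q where
  toBXEqs := h.toSurjBXEqs.toBXEqs hD hp
  s_mul_q a ξ z := by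
    induction ξ using hD.induction with
    | smul_d g b => rw [smul_smul, hq, hq, map_mul, mul_assoc]
    | add ξ η hξ hη => simp only [TensorProduct.add_tmul, smul_add, map_add, mul_add, hξ, hη]
  t_mul_q a ξ z := by
    induction ξ using hD.induction with
    | smul_d g b =>
      rw [hq, hq, ← h.t_mul_u, ← mul_assoc, ← h.comm, mul_assoc, mul_sub, ← mul_assoc,
        ← mul_assoc (t _) (s b), ← h.comm b, mul_assoc (s b)]
    | add ξ η hξ hη => simp only [TensorProduct.add_tmul, map_add, mul_add, hξ, hη]
  q_mul_s a ξ z := by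
    induction ξ using hD.induction with
    | smul_d g b =>
      rw [← smul_comm, Calculus.op_smul_d, smul_sub, smul_smul, TensorProduct.sub_tmul, map_sub,
        hq, hq, hq]
      simp only [map_mul]
      noncomm_ring
    | add ξ η hξ hη => simp only [TensorProduct.add_tmul, smul_add, map_add, add_mul, hξ, hη]
  q_mul_t a ξ z := by
    induction ξ using hD.induction with
    | smul_d g b =>
      rw [hq, hq, eq_sub_of_add_eq (h.u_mul_t a z).symm, mul_assoc, sub_mul, mul_assoc (u z),
        h.comm, mul_assoc (s b), sub_mul (u z * _), mul_sub (s b), h.comm b]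
      noncomm_ring
    | add ξ η hξ hη => simp only [TensorProduct.add_tmul, map_add, add_mul, hξ, hη]
  inv₁ ξ z := by
    have hd (i) : q (D.d (b i) ⊗ₜ z) = u z * s (b i) - s (b i) * u z := by
      simpa using hq 1 (b i) z
    -- The correction term of `ȳ • ā` lies in the image of `Aᵐᵒᵖ` and so commutes with `b`.
    have hut (a b : A) : (u z * s b - s b * u z) * t (op a) =
        u (a • z) * s b - s b * u (a • z) := by
      rw [eq_sub_of_add_eq (h.u_mul_t a z).symm, sub_mul, mul_assoc (u z), h.comm,
        mul_assoc (s b), sub_mul (u z * _), mul_sub (s b), h.comm b]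
      noncomm_ring
    induction ξ using hD.induction with
    | smul_d g a =>
      -- Expanding `(x_i, g da)` leaves two sums of the form `∑ [·, b_i] • x_i`. By the relation for
      -- the `b_i` they contract to `(z̄ • ā - (az)‾) • ḡ`, which is the image of `ev(g da, z)`.
      have h1 (i) : q (D.d (b i) ⊗ₜ z) * p (x' i ⊗ₜ (g • D.d a)) =
          (u z * s (b i) - s (b i) * u z) * v (x' i) * (t (op a) * t (op g)) -
          (u (a • z) * s (b i) - s (b i) * u (a • z)) * v (x' i) * t (op g) := by
        rw [hd, hp, ← hut]
        noncomm_ring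
      simp only [h1, Finset.sum_sub_distrib, ← Finset.sum_mul, h.inv₁]
      rw [← mul_assoc, h.u_mul_t, Q.ev_smul, MulOpposite.op_mul, map_mul]
      noncomm_ring
    | add ξ η hξ hη =>
      simp only [TensorProduct.tmul_add, map_add, mul_add, Finset.sum_add_distrib, hξ, hη,
        LinearMap.add_apply, MulOpposite.op_add]
  inv₂ z ξ := by
    have hd (j) : p (z ⊗ₜ D.d (c j)) = v z * t (op (c j)) - t (op (c j)) * v z := by
      simpa using hp z 1 (c j)
    have hvs (z : X) (a c : A) : (v z * t (op c) - t (op c) * v z) * s a =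
        v (op a • z) * t (op c) - t (op c) * v (op a • z) := by
      rw [eq_sub_of_add_eq (h.right a z).symm, sub_mul, mul_assoc (v z), ← h.comm,
        mul_assoc (t _), sub_mul (v z * _), mul_sub (t _), h.comm (P.ev z (D.d a))]
      noncomm_ring
    induction ξ using hD.induction with
    | smul_d g a =>
      -- Dually, the sums over `c_j` contract to `(zg) • a - zga = ev(zg, da)`, and `g` then moves
      -- across the pairing.
      have h1 (j) : p (z ⊗ₜ D.d (c j)) * q ((g • D.d a) ⊗ₜ y' j) =
          (v (op g • z) * t (op (c j)) - t (op (c j)) * v (op g • z)) * u (y' j) * s a -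
          (v (op a • op g • z) * t (op (c j)) - t (op (c j)) * v (op a • op g • z)) *
            u (y' j) := by
        rw [hd, hq, ← hvs _ a, ← hvs]
        noncomm_ring
      simp only [h1, Finset.sum_sub_distrib, ← Finset.sum_mul, h.inv₂]
      rw [h.right, P.ev_balanced]
      abel
    | add ξ η hξ hη =>
      simp only [TensorProduct.add_tmul, map_add, mul_add, Finset.sum_add_distrib, hξ, hη]

omit [IsScalarTower K A Ω] [IsScalarTower K Aᵐᵒᵖ Ω] [SMulCommClass A Aᵐᵒᵖ Ω] in
/-- The relations of `IB𝔛` do not depend on the choice of coevaluations. -/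
theorem IBXEqs.congr_coev {n' m' : ℕ} {ω' : Fin n' → Ω} {x' : Fin n' → X} {y' : Fin m' → Y}
    {ρ' : Fin m' → Ω} (h : IBXEqs D P Q ω x y ρ s t v p q) (hP : P.IsCoev ω x)
    (hQ : Q.IsCoev y ρ) (hP' : P.IsCoev ω' x') (hQ' : Q.IsCoev y' ρ') :
    IBXEqs D P Q ω' x' y' ρ' s t v p q where
  toBXEqs := h.toBXEqs
  s_mul_q := h.s_mul_q
  t_mul_q := h.t_mul_q
  q_mul_s := h.q_mul_s
  q_mul_t := h.q_mul_t
  inv₁ ξ z := by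
    rw [← h.inv₁]
    -- The product `(ω, z) • (x, ξ)` is balanced in `ω` and `x`, since `a` acts between the two
    -- factors.
    refine hP'.sum_eq hP ((LinearMap.mul K F).compl₁₂
      (q ∘ₗ (TensorProduct.mk K Ω Y).flip z) (p ∘ₗ (TensorProduct.mk K X Ω).flip ξ)) ?_
    intro a ω x
    simp [← h.q_mul_s, ← h.s_mul_p, mul_assoc]
  inv₂ z ξ := by
    rw [← h.inv₂]
    refine hQ'.sum_eq hQ ((LinearMap.mul K F).flip.compl₁₂
      (q ∘ₗ TensorProduct.mk K Ω Y ξ) (p ∘ₗ TensorProduct.mk K X Ω z)) ?_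
    intro a y ρ
    simp [← h.t_mul_q, ← h.p_mul_t, mul_assoc]

/-- The map `z ↦ ∑ i, (ω i, z) • x i` to `IB𝔛`. -/
def elimY (ω : Fin n → Ω) (x : Fin n → X) (v : X →ₗ[K] F) (q : Ω ⊗[K] Y →ₗ[K] F) : Y →ₗ[K] F :=
  ∑ i, LinearMap.mulRight K (v (x i)) ∘ₗ q ∘ₗ TensorProduct.mk K Ω Y (ω i)

omit [Module A Ω] [Module Aᵐᵒᵖ Ω] [Module A X] [Module Aᵐᵒᵖ X] [Module A Y] [Module Aᵐᵒᵖ Y]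
  [IsScalarTower K A Ω] [IsScalarTower K Aᵐᵒᵖ Ω] [SMulCommClass A Aᵐᵒᵖ Ω] in
theorem elimY_apply (z : Y) : elimY ω x v q z = ∑ i, q (ω i ⊗ₜ z) * v (x i) := by
  simp [elimY]

omit [IsScalarTower K A Ω] [IsScalarTower K Aᵐᵒᵖ Ω] [SMulCommClass A Aᵐᵒᵖ Ω] in
-- Passing `a` through each `x_i` leaves `ev(x_i, da)` behind; centrality of the coevaluation
-- accounts for the main term, and a triangle identity sums the remainders to `da`. Thus commutators
-- with the new generator recover `q`.
theorem IBXEqs.elimY_mul_s (h : IBXEqs D P Q ω x y ρ s t v p q) (hP : P.IsCoev ω x) (a : A)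
    (z : Y) : elimY ω x v q z * s a = s a * elimY ω x v q z + q (D.d a ⊗ₜ z) := by
  have h1 := hP.sum_smul ((LinearMap.mul K F).compl₁₂
      (q ∘ₗ (TensorProduct.mk K Ω Y).flip z) v) (fun a ξ x => by
        simp [← h.q_mul_s, ← h.left, mul_assoc]) a
  simp only [LinearMap.compl₁₂_apply, LinearMap.mul_apply', LinearMap.comp_apply,
    LinearMap.flip_apply, TensorProduct.mk_apply, ← h.s_mul_q, mul_assoc] at h1
  rw [elimY_apply, Finset.mul_sum, h1]
  simp only [Finset.sum_mul, mul_assoc, h.right, mul_add, Finset.sum_add_distrib, h.q_mul_s]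
  rw [← map_sum, ← TensorProduct.sum_tmul, hP.1]

omit [IsScalarTower K A Ω] [IsScalarTower K Aᵐᵒᵖ Ω] [SMulCommClass A Aᵐᵒᵖ Ω] in
theorem IBXEqs.q_smul_d (h : IBXEqs D P Q ω x y ρ s t v p q) (hP : P.IsCoev ω x) (a b : A)
    (z : Y) : s a * (elimY ω x v q z * s b - s b * elimY ω x v q z) =
      q ((a • D.d b) ⊗ₜ z) := by
  rw [h.elimY_mul_s hP, add_sub_cancel_left, h.s_mul_q]

omit [IsScalarTower K A Ω] [SMulCommClass A Aᵐᵒᵖ Ω] in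
theorem IBXEqs.toSurjIBXEqs
    (h : IBXEqs D P Q (fun i => D.d (b i)) x' y' (fun j => D.d (c j)) s t v p q)
    (hP : P.IsCoev (fun i => D.d (b i)) x') :
    SurjIBXEqs D P Q b x' y' c s t v (elimY (fun i => D.d (b i)) x' v q) where
  toSurjBXEqs := h.toBXEqs.toSurjBXEqs
  t_mul_u a z := by simp only [elimY_apply, Finset.mul_sum, ← mul_assoc, h.t_mul_q]
  u_mul_t a z := by
    -- Moving `ā` left past `x_i` produces `(x_i, da)`, and `∑ (db_i, z) • (x_i, da)` is the image
    -- of `ev(da, z)` by the first inversion relation.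
    simp only [elimY_apply, Finset.sum_mul, mul_assoc, h.bar, mul_add, Finset.sum_add_distrib,
      h.inv₁]
    simp only [← mul_assoc, h.q_mul_t]
  surj_u {n} r r' z hr := by
    rw [Calculus.sum_tmul_mem_N] at hr
    have h0 : ∑ m, D.d (r m * r' m) = 0 := by rw [← map_sum, hr.1, map_zero]
    -- Membership in `𝒩` gives `∑ (dr) r' = 0`; the form `∑ r dr'` needed here vanishes as well, by
    -- differentiating `∑ r r' = 0`.
    have h1 : ∑ m, r m • D.d (r' m) = 0 := by
      simpa [D.leibniz, Finset.sum_add_distrib, hr.2] using h0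
    calc ∑ m, s (r m) * elimY (fun i => D.d (b i)) x' v q z * s (r' m)
        = s (∑ m, r m * r' m) * elimY (fun i => D.d (b i)) x' v q z +
            q ((∑ m, r m • D.d (r' m)) ⊗ₜ z) := by
          simp only [mul_assoc, h.elimY_mul_s hP, mul_add, h.s_mul_q, Finset.sum_add_distrib,
            TensorProduct.sum_tmul, map_sum, map_mul, Finset.sum_mul]
      _ = 0 := by simp [hr.1, h1]
  inv₁ z := by
    simp only [h.elimY_mul_s hP, add_sub_cancel_left]
    exact (elimY_apply z).symm
  inv₂ z := by
    have hd (j) : v z * t (op (c j)) - t (op (c j)) * v z = p (z ⊗ₜ D.d (c j)) := by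
      rw [h.bar, add_sub_cancel_left]
    simp only [hd, elimY_apply, Finset.mul_sum, ← mul_assoc]
    -- With the sum over `j` inside, the second inversion relation contracts it to `ev(z, db_i)`; a
    -- triangle identity for `X` then contracts the sum over `i`.
    rw [Finset.sum_comm]
    simp only [← Finset.sum_mul, h.inv₂, h.left]
    rw [← map_sum, hP.2]

end Inverse

end

/-! ### The isomorphisms -/

section

variable {K A Ω X Y : Type*} [Field K] [Ring A] [Algebra K A]
  [AddCommGroup Ω] [Module K Ω] [Module A Ω] [Module Aᵐᵒᵖ Ω]
  [IsScalarTower K A Ω] [IsScalarTower K Aᵐᵒᵖ Ω] [SMulCommClass A Aᵐᵒᵖ Ω]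
  [AddCommGroup X] [Module K X] [Module A X] [Module Aᵐᵒᵖ X]
  [AddCommGroup Y] [Module K Y] [Module A Y] [Module Aᵐᵒᵖ Y]
  {D : Calculus K A Ω} {P : LeftPairing K A Ω X} {Q : RightPairing K A Ω Y}

theorem exists_algEquiv_surjBX (hD : D.IsSurjective) :
    ∃ β : BX D P ≃ₐ[K] SurjBX D P,
      (∀ a a' : A, β (BX.e D P (a ⊗ₜ op a')) = SurjBX.s D P a * SurjBX.t D P (op a')) ∧
      (∀ z : X, β (BX.v D P z) = SurjBX.v D P z) ∧
      ∀ (z : X) (a b : A), β (BX.p D P (z ⊗ₜ (a • D.d b))) =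
        (SurjBX.v D P z * SurjBX.t D P (op b) - SurjBX.t D P (op b) * SurjBX.v D P z) *
          SurjBX.t D P (op a) := by
  have hS := SurjBX.eqs (D := D) (P := P)
  have hB := BX.eqs (D := D) (P := P)
  obtain ⟨p, hp⟩ := hS.exists_p hD
  let f := BX.lift (hS.toBXEqs hD hp)
  let g := SurjBX.lift hB.toSurjBXEqs
  refine ⟨AlgEquiv.ofAlgHom f g ?_ ?_, ?_, ?_, ?_⟩
  · apply SurjBX.algHom_ext <;> intro <;> simp [f, g]
  · apply BX.algHom_ext
    · intro; simp [f, g]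
    · intro; simp [f, g]
    · intro; simp [f, g]
    · intro x ξ
      induction ξ using hD.induction with
      -- The generators of `X ⊗ Ω` return to themselves because in `B𝔛` they already equal the
      -- commutators that replace them.
      | smul_d a b => simp [f, g, hp, hB.p_smul_d]
      | add ξ η hξ hη => simp only [TensorProduct.tmul_add, map_add, hξ, hη]
  · intro a a'; simp [f]
  · intro z; simp [f]
  · intro z a b; simp [f, hp]

theorem exists_algEquiv_surjIBX (hD : D.IsSurjective) {n m k l : ℕ} {ω : Fin n → Ω}
    {x : Fin n → X} {y : Fin m → Y} {ρ : Fin m → Ω} {b : Fin k → A} {x' : Fin k → X}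
    {y' : Fin l → Y} {c : Fin l → A} (hP : P.IsCoev ω x) (hQ : Q.IsCoev y ρ)
    (hP' : P.IsCoev (fun i => D.d (b i)) x') (hQ' : Q.IsCoev y' (fun j => D.d (c j))) :
    ∃ κ : IBX D P Q ω x y ρ ≃ₐ[K] SurjIBX D P Q b x' y' c,
      (∀ a a' : A, κ (IBX.e D P Q ω x y ρ (a ⊗ₜ op a')) =
        SurjIBX.s D P Q b x' y' c a * SurjIBX.t D P Q b x' y' c (op a')) ∧
      (∀ z : X, κ (IBX.v D P Q ω x y ρ z) = SurjIBX.v D P Q b x' y' c z) ∧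
      (∀ (z : X) (a a' : A), κ (IBX.p D P Q ω x y ρ (z ⊗ₜ (a • D.d a'))) =
        (SurjIBX.v D P Q b x' y' c z * SurjIBX.t D P Q b x' y' c (op a') -
          SurjIBX.t D P Q b x' y' c (op a') * SurjIBX.v D P Q b x' y' c z) *
            SurjIBX.t D P Q b x' y' c (op a)) ∧
      (∀ (a a' : A) (z : Y), κ (IBX.q D P Q ω x y ρ ((a • D.d a') ⊗ₜ z)) =
        SurjIBX.s D P Q b x' y' c a *
          (SurjIBX.u D P Q b x' y' c z * SurjIBX.s D P Q b x' y' c a' -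
            SurjIBX.s D P Q b x' y' c a' * SurjIBX.u D P Q b x' y' c z)) ∧
      ∀ z : Y, κ.symm (SurjIBX.u D P Q b x' y' c z) =
        ∑ i, IBX.q D P Q ω x y ρ (D.d (b i) ⊗ₜ z) * IBX.v D P Q ω x y ρ (x' i) := by
  have hS := SurjIBX.eqs (D := D) (P := P) (Q := Q) (b := b) (x := x') (y := y') (c := c)
  -- The given coevaluations are exchanged for the exact ones here, and back again in `f`.
  have hB := (IBX.eqs (D := D) (P := P) (Q := Q) (ω := ω) (x := x) (y := y) (ρ := ρ)).congr_coev
    hP hQ hP' hQ'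
  obtain ⟨p, hp⟩ := hS.toSurjBXEqs.exists_p hD
  obtain ⟨q, hq⟩ := hS.exists_q hD
  let f := IBX.lift ((hS.toIBXEqs hD hp hq).congr_coev hP' hQ' hP hQ)
  let g := SurjIBX.lift (hB.toSurjIBXEqs hP')
  have hd (a : A) (z : Y) : q (D.d a ⊗ₜ z) =
      SurjIBX.u D P Q b x' y' c z * SurjIBX.s D P Q b x' y' c a -
        SurjIBX.s D P Q b x' y' c a * SurjIBX.u D P Q b x' y' c z := by
    simpa using hq 1 a z
  refine ⟨AlgEquiv.ofAlgHom f g ?_ ?_, ?_, ?_, ?_, ?_, ?_⟩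
  · apply SurjIBX.algHom_ext
    · intro; simp [f, g]
    · intro; simp [f, g]
    · intro; simp [f, g]
    · intro z
      -- The round trip sends `z̄` to `∑ [z̄, b_i] • x'_i`, so the relation imposed for the `b_i` is
      -- what makes it the identity.
      simp [f, g, elimY_apply, hd, hS.inv₁]
  · apply IBX.algHom_ext
    · intro; simp [f, g]
    · intro; simp [f, g]
    · intro; simp [f, g]
    · intro x ξ
      induction ξ using hD.induction with
      | smul_d a b => simp [f, g, hp, hB.p_smul_d]
      | add ξ η hξ hη => simp only [TensorProduct.tmul_add, map_add, hξ, hη]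
    · intro ξ z
      induction ξ using hD.induction with
      | smul_d a b => simp [f, g, hq, hB.q_smul_d hP']
      | add ξ η hξ hη => simp only [TensorProduct.add_tmul, map_add, hξ, hη]
  · intro a a'; simp [f]
  · intro z; simp [f]
  · intro z a b; simp [f, hp]
  · intro a a' z; simp [f, hq]
  · intro z; simp [g, elimY_apply]

end

end

end SurjCalc

theorem mainTheorem10 {K A Ω X Y : Type*} [Field K] [Ring A] [Algebra K A]
    [AddCommGroup Ω] [Module K Ω] [Module A Ω] [Module Aᵐᵒᵖ Ω]
    [IsScalarTower K A Ω] [IsScalarTower K Aᵐᵒᵖ Ω]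
    [SMulCommClass A Aᵐᵒᵖ Ω]
    [AddCommGroup X] [Module K X] [Module A X] [Module Aᵐᵒᵖ X]
    [IsScalarTower K A X] [IsScalarTower K Aᵐᵒᵖ X] [SMulCommClass A Aᵐᵒᵖ X]
    [AddCommGroup Y] [Module K Y] [Module A Y] [Module Aᵐᵒᵖ Y]
    [IsScalarTower K A Y] [IsScalarTower K Aᵐᵒᵖ Y] [SMulCommClass A Aᵐᵒᵖ Y]
    (D : SurjCalc.Calculus K A Ω) (hD : D.IsSurjective)
    (P : SurjCalc.LeftPairing K A Ω X) (Q : SurjCalc.RightPairing K A Ω Y)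
    {n m : ℕ} (ω : Fin n → Ω) (x : Fin n → X) (hP : P.IsCoev ω x)
    (y : Fin m → Y) (ρ : Fin m → Ω) (hQ : Q.IsCoev y ρ) :
    (∃ (k : ℕ) (b : Fin k → A) (x' : Fin k → X), P.IsCoev (fun i => D.d (b i)) x') ∧
    (∃ (l : ℕ) (y' : Fin l → Y) (c : Fin l → A), Q.IsCoev y' (fun j => D.d (c j))) ∧
    (∃ β : SurjCalc.BX D P ≃ₐ[K] SurjCalc.SurjBX D P,
      (∀ a a' : A, β (SurjCalc.BX.e D P (a ⊗ₜ op a')) =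
        SurjCalc.SurjBX.s D P a * SurjCalc.SurjBX.t D P (op a')) ∧
      (∀ z : X, β (SurjCalc.BX.v D P z) = SurjCalc.SurjBX.v D P z) ∧
      (∀ (z : X) (a b : A), β (SurjCalc.BX.p D P (z ⊗ₜ (a • D.d b))) =
        (SurjCalc.SurjBX.v D P z * SurjCalc.SurjBX.t D P (op b) -
          SurjCalc.SurjBX.t D P (op b) * SurjCalc.SurjBX.v D P z) *
            SurjCalc.SurjBX.t D P (op a))) ∧
    ∀ {k l : ℕ} (b : Fin k → A) (x' : Fin k → X) (y' : Fin l → Y) (c : Fin l → A),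
      P.IsCoev (fun i => D.d (b i)) x' → Q.IsCoev y' (fun j => D.d (c j)) →
      ∃ κ : SurjCalc.IBX D P Q ω x y ρ ≃ₐ[K] SurjCalc.SurjIBX D P Q b x' y' c,
        (∀ a a' : A, κ (SurjCalc.IBX.e D P Q ω x y ρ (a ⊗ₜ op a')) =
          SurjCalc.SurjIBX.s D P Q b x' y' c a *
            SurjCalc.SurjIBX.t D P Q b x' y' c (op a')) ∧
        (∀ z : X, κ (SurjCalc.IBX.v D P Q ω x y ρ z) = SurjCalc.SurjIBX.v D P Q b x' y' c z) ∧
        (∀ (z : X) (a a' : A), κ (SurjCalc.IBX.p D P Q ω x y ρ (z ⊗ₜ (a • D.d a'))) =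
          (SurjCalc.SurjIBX.v D P Q b x' y' c z * SurjCalc.SurjIBX.t D P Q b x' y' c (op a') -
            SurjCalc.SurjIBX.t D P Q b x' y' c (op a') * SurjCalc.SurjIBX.v D P Q b x' y' c z) *
              SurjCalc.SurjIBX.t D P Q b x' y' c (op a)) ∧
        (∀ (a a' : A) (z : Y), κ (SurjCalc.IBX.q D P Q ω x y ρ ((a • D.d a') ⊗ₜ z)) =
          SurjCalc.SurjIBX.s D P Q b x' y' c a *
            (SurjCalc.SurjIBX.u D P Q b x' y' c z * SurjCalc.SurjIBX.s D P Q b x' y' c a' -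
              SurjCalc.SurjIBX.s D P Q b x' y' c a' * SurjCalc.SurjIBX.u D P Q b x' y' c z)) ∧
        (∀ z : Y, κ.symm (SurjCalc.SurjIBX.u D P Q b x' y' c z) =
          ∑ i, SurjCalc.IBX.q D P Q ω x y ρ (D.d (b i) ⊗ₜ z) *
            SurjCalc.IBX.v D P Q ω x y ρ (x' i)) :=
  ⟨hP.exists_d hD, hQ.exists_d hD, SurjCalc.exists_algEquiv_surjBX hD,
    fun _ _ _ _ hP' hQ' => SurjCalc.exists_algEquiv_surjIBX hD hP hQ hP' hQ'⟩
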